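/- Let $u\ge 1$, $\mathcal U=\{1,\dots,u\}$, and let $\mathcal S=\{S^1,\dots,S^s\}$ be a family of subsets of $\mathcal U$. A \emph{solution} of the set splitting instance $\langle\mathcal U,\mathcal S\rangle$ is a partition of $\mathcal U$ into two disjoint non-empty sets $\mathcal U_1,\mathcal U_2$ such that $S^i\not\subseteq\mathcal U_1$ and $S^i\not\subseteq\mathcal U_2$ for all $i$. Assume that the instance is in \emph{simple form}: no $S^i$ is a singleton, every element of $\mathcal U$ lies in some $S^i$, no $S^i$ equals $\mathcal U$, and $S^i\not\subseteq S^j$ for $i\ne j$. Write $S^i=\{s^i_1<\dots<s^i_{k_i}\}$, where $k_i=|S^i|$, and $c=\sum_{i=1}^s k_i$. Let $\Gamma$ be the directed graph with vertices $v^{U,i}_1,\dots,v^{U,i}_4$ ($1\le i\le u$), $v^{S,i}_1,\dots,v^{S,i}_{5+6k_i}$ ($1\le i\le s$), $v^C_1$, $v^C_2$, and the following arcs. Step 1. For each $i\in\mathcal U$: $(v^{U,i}_1,v^{U,i}_2)$, $(v^{U,i}_1,v^{U,i}_3)$, $(v^{U,i}_2,v^{U,i}_3)$, $(v^{U,i}_3,v^{U,i}_2)$.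 Step 2. For each $1\le i\le s$, with $k=k_i$, writing $m$ for $v^{S,i}_m$ and $a_j=3+3j$, $b_j=4+3j$, $c_j=5+3j$: (I) $(1,6)$, $(1,6+3k)$, $(5+3k,2)$, $(5+6k,2)$, $(3,4)$, $(4,3)$, $(4,5)$, $(5,4)$; (II) for $1\le j\le k$ and $o\in\{0,3k\}$: $(a_j+o,b_j+o)$, $(b_j+o,a_j+o)$, $(b_j+o,c_j+o)$, $(c_j+o,b_j+o)$; (III) for $1\le j\le k-1$: $(c_j,c_j+1)$, $(c_j,c_j+1+3k)$, $(c_j+3k,c_j+1)$, $(c_j+3k,c_j+1+3k)$, $(c_j,3)$, $(3,c_j+1)$, $(c_j+3k,5)$, $(5,c_j+1+3k)$. Step 3. $(v^{U,u}_4,v^C_1)$, $(v^C_1,v^{S,1}_1)$, $(v^{S,s}_2,v^C_2)$, $(v^C_2,v^{U,1}_1)$; $(v^{U,i}_4,v^{U,i+1}_1)$ for $1\le i<u$; $(v^{S,i}_2,v^{S,i+1}_1)$ for $1\le i<s$. Further, for each $x\in\mathcal U$, let $F_1<\dots<F_f$ be the indices of the sets that contain $x$, let $x$ be the $R_j$-th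 entry of $S^{F_j}$, and put $d_j=3+3R_j$, $e_j=3+3k_{F_j}+3R_j$; then the arcs $(v^{U,x}_2,v^{S,F_1}_{2+e_1})$, $(v^{S,F_f}_{e_f},v^{U,x}_4)$, $(v^{U,x}_3,v^{S,F_1}_{2+d_1})$, $(v^{S,F_f}_{d_f},v^{U,x}_4)$, and, for $1\le j<f$, $(v^{S,F_j}_{e_j},v^{S,F_{j+1}}_{2+e_{j+1}})$ and $(v^{S,F_j}_{d_j},v^{S,F_{j+1}}_{2+d_{j+1}})$. A Hamiltonian cycle of $\Gamma$, traversed from $v^{U,1}_1$, \emph{corresponds} to the pair $(\mathcal U_1,\mathcal U_2)$ where $\mathcal U_1$ is the set of the $i\in\mathcal U$ for which $v^{U,i}_2$ is visited after $v^{U,i}_3$, and $\mathcal U_2$ the set of the $i$ for which $v^{U,i}_3$ is visited after $v^{U,i}_2$. Then $\Gamma$ has $4u+5s+6c+2$ vertices and $7u+s+18c+2$ arcs, and: (i) If the instance has no solution, then $\Gamma$ has no Hamiltonian cycle. (ii) For every solution $(\mathcal U_1,\mathcal U_2)$ there is a Hamiltonian cycle of $\Gamma$ that corresponds to $(\mathcal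 U_1,\mathcal U_2)$. (iii) For every Hamiltonian cycle of $\Gamma$, the corresponding pair $(\mathcal U_1,\mathcal U_2)$ is a solution, and there is a single Turing machine that computes it in polynomial time for all instances: given an instance in simple form with $u\ge1$ and the list of the vertices of a Hamiltonian cycle of its graph $\Gamma$, in cyclic order starting anywhere (indices in binary), it outputs for $i=1,\dots,u$ whether $i\in\mathcal U_1$ or $i\in\mathcal U_2$, in a number of steps polynomial in the length of the input. -/

import Mathlib

/-- An instance of the set splitting problem: the universe is `{1, …, u}`, represented by `Fin u`
(element `x : Fin u` stands for `x + 1`), and `S` is the family of subsets `S^1, …, S^s`. -/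
structure SSP where
  /-- the size of the universe -/
  u : ℕ
  /-- the number of subsets -/
  s : ℕ
  /-- the subsets -/
  S : Fin s → Finset (Fin u)

/-- A Hamiltonian cycle of a directed graph, written as the list of its vertices in cyclic order
(starting anywhere): every vertex occurs exactly once, and there is an arc from each entry to the
cyclically next one. -/
def IsHamiltonianCycle {V : Type*} (G : Digraph V) (l : List V) : Prop :=
  l.Nodup ∧ (∀ v, v ∈ l) ∧
    ∀ (n : ℕ) (h : n < l.length),
      G.Adj l[n] (l[(n + 1) % l.length]'(Nat.mod_lt _ (Nat.zero_lt_of_lt h)))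

namespace SSP

/-- The total number `c` of elements over all the subsets. -/
def totalCard (I : SSP) : ℕ := ∑ i, (I.S i).card

/-- Simple form: no set is a singleton, every element lies in some set, no set is the whole
universe, and no set is contained in another set of the family. -/
structure SimpleForm (I : SSP) : Prop where
  card_ne_one : ∀ i, (I.S i).card ≠ 1
  covered : ∀ x, ∃ i, x ∈ I.S i
  ne_univ : ∀ i, I.S i ≠ Finset.univ
  not_subset : ∀ i j, i ≠ j → ¬ I.S i ⊆ I.S j

/-- `(A, B)` is a solution: a partition of the universe into two disjoint non-empty subsets
such that no `S^i` is contained in `A` and none is contained in `B`. -/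
structure IsSolution (I : SSP) (A B : Finset (Fin I.u)) : Prop where
  nonempty_left : A.Nonempty
  nonempty_right : B.Nonempty
  disjoint : Disjoint A B
  union_eq : A ∪ B = Finset.univ
  split : ∀ i, ¬ I.S i ⊆ A ∧ ¬ I.S i ⊆ B

/-- The number `k = |S^i|`. -/
abbrev k (I : SSP) (i : Fin I.s) : ℕ := (I.S i).card

/-- The entries of `S^i` in ascending order (`j : Fin k` stands for position `j + 1`). -/
def entry (I : SSP) (i : Fin I.s) (j : Fin (I.k i)) : Fin I.u :=
  (I.S i).orderEmbOfFin rfl j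

/-- The vertices of the graph. With `i` and `j` counted from 1 and `k = |S^i|`:
* `u1 i, …, u4 i` are `v^{U,i}_1, …, v^{U,i}_4`;
* `s1 i, …, s5 i` are `v^{S,i}_1, …, v^{S,i}_5`;
* `a i false j`, `b i false j`, `c i false j` are `v^{S,i}_{3+3j}`, `v^{S,i}_{4+3j}`,
  `v^{S,i}_{5+3j}` (the `j`-th entry of `S^i` is in the first part), and `a i true j`,
  `b i true j`, `c i true j` are `v^{S,i}_{3+3j+3k}`, `v^{S,i}_{4+3j+3k}`, `v^{S,i}_{5+3j+3k}`
  (the `j`-th entry of `S^i` is in the second part);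
* `conn1`, `conn2` are the connecting vertices `v^C_1`, `v^C_2`. -/
inductive Vertex (I : SSP) : Type
  | u1 (i : Fin I.u) | u2 (i : Fin I.u) | u3 (i : Fin I.u) | u4 (i : Fin I.u)
  | s1 (i : Fin I.s) | s2 (i : Fin I.s) | s3 (i : Fin I.s) | s4 (i : Fin I.s) | s5 (i : Fin I.s)
  | a (i : Fin I.s) (t : Bool) (j : Fin (I.k i))
  | b (i : Fin I.s) (t : Bool) (j : Fin (I.k i))
  | c (i : Fin I.s) (t : Bool) (j : Fin (I.k i))
  | conn1 | conn2
  deriving DecidableEq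

open Vertex in
/-- The arcs of the graph. -/
inductive Arc (I : SSP) : I.Vertex → I.Vertex → Prop
  -- Step 1: the component of an element
  | u12 i : Arc I (u1 i) (u2 i)
  | u13 i : Arc I (u1 i) (u3 i)
  | u23 i : Arc I (u2 i) (u3 i)
  | u32 i : Arc I (u3 i) (u2 i)
  -- Step 2, group I
  | s1a i t (j : Fin (I.k i)) : j.val = 0 → Arc I (s1 i) (a i t j)
  | cs2 i t (j : Fin (I.k i)) : j.val + 1 = I.k i → Arc I (c i t j) (s2 i)
  | s34 i : Arc I (s3 i) (s4 i)
  | s43 i : Arc I (s4 i) (s3 i)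
  | s45 i : Arc I (s4 i) (s5 i)
  | s54 i : Arc I (s5 i) (s4 i)
  -- Step 2, group II
  | ab i t j : Arc I (a i t j) (b i t j)
  | ba i t j : Arc I (b i t j) (a i t j)
  | bc i t j : Arc I (b i t j) (c i t j)
  | cb i t j : Arc I (c i t j) (b i t j)
  -- Step 2, group III
  | ca i t t' (j j' : Fin (I.k i)) : j.val + 1 = j'.val → Arc I (c i t j) (a i t' j')
  | cs3 i (j : Fin (I.k i)) : j.val + 1 < I.k i → Arc I (c i false j) (s3 i)
  | s3a i (j' : Fin (I.k i)) : 0 < j'.val → Arc I (s3 i) (a i false j')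
  | cs5 i (j : Fin (I.k i)) : j.val + 1 < I.k i → Arc I (c i true j) (s5 i)
  | s5a i (j' : Fin (I.k i)) : 0 < j'.val → Arc I (s5 i) (a i true j')
  -- Step 3, linking the components into a cycle
  | u4conn1 (i : Fin I.u) : i.val + 1 = I.u → Arc I (u4 i) conn1
  | conn1s1 (i : Fin I.s) : i.val = 0 → Arc I conn1 (s1 i)
  | s2conn2 (i : Fin I.s) : i.val + 1 = I.s → Arc I (s2 i) conn2
  | conn2u1 (i : Fin I.u) : i.val = 0 → Arc I conn2 (u1 i)
  | u4u1 (i i' : Fin I.u) : i.val + 1 = i'.val → Arc I (u4 i) (u1 i')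
  | s2s1 (i i' : Fin I.s) : i.val + 1 = i'.val → Arc I (s2 i) (s1 i')
  -- Step 3, the two paths of an element `x = s^i_j`: from `v^{U,x}_2` or `v^{U,x}_3` to the first
  -- set containing `x`, from each set containing `x` to the next one, and from the last one back
  | u2c i j : (∀ i' < i, I.entry i j ∉ I.S i') → Arc I (u2 (I.entry i j)) (c i true j)
  | u3c i j : (∀ i' < i, I.entry i j ∉ I.S i') → Arc I (u3 (I.entry i j)) (c i false j)
  | au4 i t j : (∀ i' > i, I.entry i j ∉ I.S i') → Arc I (a i t j) (u4 (I.entry i j))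
  | ac i i' t j j' : i < i' → I.entry i j = I.entry i' j' →
      (∀ m, i < m → m < i' → I.entry i j ∉ I.S m) → Arc I (a i t j) (c i' t j')

/-- The directed graph constructed from the instance. -/
def graph (I : SSP) : Digraph I.Vertex where
  Adj := I.Arc

/-- The listing of a cycle `l`, rotated so that it starts at `v^{U,1}_1`. -/
def tour (I : SSP) (hu : 0 < I.u) (l : List I.Vertex) : List I.Vertex :=
  l.rotate (l.idxOf (Vertex.u1 ⟨0, hu⟩))

/-- The elements `i` for which `v^{U,i}_2` is visited last, i.e. after `v^{U,i}_3`. -/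
def firstPart (I : SSP) (hu : 0 < I.u) (l : List I.Vertex) : Finset (Fin I.u) :=
  {i | (I.tour hu l).idxOf (Vertex.u3 i) < (I.tour hu l).idxOf (Vertex.u2 i)}

/-- The elements `i` for which `v^{U,i}_3` is visited last, i.e. after `v^{U,i}_2`. -/
def secondPart (I : SSP) (hu : 0 < I.u) (l : List I.Vertex) : Finset (Fin I.u) :=
  {i | (I.tour hu l).idxOf (Vertex.u2 i) < (I.tour hu l).idxOf (Vertex.u3 i)}

/-- The input alphabet for instances and cycles written as words: binary digits, the tags
`U`, `S`, `C` of the three kinds of vertices, and three separators. -/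
inductive Sym : Type
  | bit (b : Bool)
  | U | S | C
  | comma | semi | hash
  deriving DecidableEq, Fintype

/-- The binary notation of a number (least significant digit first). -/
def binary (n : ℕ) : List Sym := n.bits.map Sym.bit

/-- The word for `v^{K,i}_m`, with the indices `i` and `m` in binary. -/
def encodeLabel (K : Sym) (i m : ℕ) : List Sym :=
  K :: (binary i ++ Sym.comma :: (binary m ++ [Sym.semi]))

/-- The word for a vertex: its kind, its component and its number in the component. -/
def encodeVertex (I : SSP) : I.Vertex → List Sym
  | .u1 i => encodeLabel Sym.U (i + 1) 1
  | .u2 i => encodeLabel Sym.U (i + 1) 2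
  | .u3 i => encodeLabel Sym.U (i + 1) 3
  | .u4 i => encodeLabel Sym.U (i + 1) 4
  | .s1 i => encodeLabel Sym.S (i + 1) 1
  | .s2 i => encodeLabel Sym.S (i + 1) 2
  | .s3 i => encodeLabel Sym.S (i + 1) 3
  | .s4 i => encodeLabel Sym.S (i + 1) 4
  | .s5 i => encodeLabel Sym.S (i + 1) 5
  | .a i t j => encodeLabel Sym.S (i + 1) (3 + 3 * (j + 1) + if t then 3 * I.k i else 0)
  | .b i t j => encodeLabel Sym.S (i + 1) (4 + 3 * (j + 1) + if t then 3 * I.k i else 0)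
  | .c i t j => encodeLabel Sym.S (i + 1) (5 + 3 * (j + 1) + if t then 3 * I.k i else 0)
  | .conn1 => Sym.C :: (binary 1 ++ [Sym.semi])
  | .conn2 => Sym.C :: (binary 2 ++ [Sym.semi])

/-- The word for an instance: `u`, followed by the sets, each as the list of its entries. -/
def encodeInstance (I : SSP) : List Sym :=
  binary I.u ++ Sym.semi :: (List.finRange I.s).flatMap fun i =>
    ((List.finRange (I.k i)).flatMap fun j => binary (I.entry i j + 1) ++ [Sym.comma]) ++
      [Sym.semi]

/-- The inputs of the recovery problem: an instance in simple form with non-empty universe,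
together with a Hamiltonian cycle of its graph. -/
structure CycleInput where
  /-- the instance -/
  I : SSP
  simple : I.SimpleForm
  u_pos : 0 < I.u
  /-- the cycle, listed from an arbitrary vertex on -/
  l : List I.Vertex
  isHamiltonianCycle : IsHamiltonianCycle I.graph l

/-- The word for an input. -/
def CycleInput.encode (x : CycleInput) : List Sym :=
  x.I.encodeInstance ++ Sym.hash :: x.l.flatMap x.I.encodeVertex

/-- The answer: for each element of the universe in turn, whether it is put in the first part
(`true`) or in the second part (`false`) of the partition read off from the cycle. -/
def CycleInput.readOff (x : CycleInput) : List Bool :=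
  List.ofFn fun i : Fin x.I.u => decide (i ∈ x.I.firstPart x.u_pos x.l)

end SSP

/-! ### Forced structure of a cycle cover of the graph. -/

namespace SSP

variable {I : SSP}

open Vertex

/-! From a cycle to a solution. View the cycle as its successor permutation `σ`; nearly everything
follows from local degree constraints and the absence of 2-cycles. From `u1 x` the cycle must pass
both `u2 x` and `u3 x` in succession, and the one passed last defines `side x`. The middle vertex
`b` of a triple is adjacent only to `a` and `c`, so each triple is run either forward (`a`, `b`,
`c`) or backward (`c`, `b`, `a`). Backward runs are entered at `c` along the path of the element, so
induction over the sets containing `x` shows that the triples of `x` in part `side x` are backward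
and those in the other part forward (`backward`, `forward`). Likewise `s4 i` forces a detour joining
`s3 i` and `s5 i`. Each end of it meets a forward triple, one in either part, so `S^i` has elements
of both sides (`exists_side_eq`). This gives (i) and the first half of (iii).

From a solution to a cycle. Run through the elements, each followed by its backward triples, then
through the sets, each visiting its forward triples in order. Since `S^i` is split, two neighbouring
entries lie on different sides, and the detour through `s3`, `s4`, `s5` fits between them
(`isChain_flatMap_forwardTriple`). All vertices occur and the length is the number of vertices, so
nothing repeats.

Reading off. The backward chain of `x` ends in `u4 x`, which leads to the next element, so the tour
meets the `u1 x` in ascending order (`strictMono`). The answers are therefore produced in order by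
asking, at each `u1`, whether `u3` comes next. A finite automaton reduces each vertex word to one of
five marks, and two stacks undo the arbitrary starting point of the list, giving linear time. -/

theorem entry_injective (i : Fin I.s) : Function.Injective (I.entry i) :=
  ((I.S i).orderEmbOfFin rfl).injective

theorem entry_mem (i : Fin I.s) (j : Fin (I.k i)) : I.entry i j ∈ I.S i :=
  (I.S i).orderEmbOfFin_mem rfl j

theorem exists_entry_eq {i : Fin I.s} {x : Fin I.u} (hx : x ∈ I.S i) : ∃ j, I.entry i j = x := by
  have h : x ∈ Set.range ((I.S i).orderEmbOfFin rfl) := by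
    rw [Finset.range_orderEmbOfFin]; exact hx
  exact h

/-- The vertex of the component of `x` that is visited last if `x` is put in the first part
(`t = true`) or the second part (`t = false`). -/
def lastVertex (t : Bool) (x : Fin I.u) : I.Vertex := if t then u2 x else u3 x

@[simp] theorem lastVertex_true (x : Fin I.u) : lastVertex true x = u2 x := rfl

@[simp] theorem lastVertex_false (x : Fin I.u) : lastVertex false x = u3 x := rfl

namespace Arc

variable {v w : I.Vertex}

theorem of_u1 {x : Fin I.u} (h : Arc I (u1 x) w) : ∃ t, w = lastVertex t x := by
  cases h
  exacts [⟨true, rfl⟩, ⟨false, rfl⟩]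

theorem of_lastVertex {t : Bool} {x : Fin I.u} (h : Arc I (lastVertex t x) w) :
    w = lastVertex (!t) x ∨ ∃ i j, I.entry i j = x ∧ (∀ i' < i, x ∉ I.S i') ∧ w = c i t j := by
  cases t
  · rw [lastVertex_false] at h
    cases h with
    | u32 => exact Or.inl rfl
    | u3c i j hf => exact Or.inr ⟨i, j, rfl, hf, rfl⟩
  · rw [lastVertex_true] at h
    cases h with
    | u23 => exact Or.inl rfl
    | u2c i j hf => exact Or.inr ⟨i, j, rfl, hf, rfl⟩

theorem to_lastVertex {t : Bool} {x : Fin I.u} (h : Arc I v (lastVertex t x)) :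
    v = u1 x ∨ v = lastVertex (!t) x := by
  cases t
  · rw [lastVertex_false] at h
    cases h <;> simp
  · rw [lastVertex_true] at h
    cases h <;> simp

theorem to_b {i : Fin I.s} {t : Bool} {j : Fin (I.k i)} (h : Arc I v (b i t j)) :
    v = a i t j ∨ v = c i t j := by
  cases h <;> simp

theorem of_b {i : Fin I.s} {t : Bool} {j : Fin (I.k i)} (h : Arc I (b i t j) w) :
    w = a i t j ∨ w = c i t j := by
  cases h <;> simp

theorem of_a {i : Fin I.s} {t : Bool} {j : Fin (I.k i)} (h : Arc I (a i t j) w) :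
    w = b i t j ∨ ((∀ i' > i, I.entry i j ∉ I.S i') ∧ w = u4 (I.entry i j)) ∨
      ∃ i' j', i < i' ∧ I.entry i j = I.entry i' j' ∧
        (∀ m, i < m → m < i' → I.entry i j ∉ I.S m) ∧ w = c i' t j' := by
  cases h with
  | ab => exact Or.inl rfl
  | au4 _ _ _ hl => exact Or.inr (Or.inl ⟨hl, rfl⟩)
  | ac _ i' _ _ j' h1 h2 h3 => exact Or.inr (Or.inr ⟨i', j', h1, h2, h3, rfl⟩)

theorem to_c {i : Fin I.s} {t : Bool} {j : Fin (I.k i)} (h : Arc I v (c i t j)) :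
    v = b i t j ∨ ((∀ i' < i, I.entry i j ∉ I.S i') ∧ v = lastVertex t (I.entry i j)) ∨
      ∃ i' j', i' < i ∧ I.entry i' j' = I.entry i j ∧ v = a i' t j' := by
  cases h with
  | bc => exact Or.inl rfl
  | u2c _ _ hf => exact Or.inr (Or.inl ⟨hf, rfl⟩)
  | u3c _ _ hf => exact Or.inr (Or.inl ⟨hf, rfl⟩)
  | ac i' _ _ j' _ h1 h2 h3 => exact Or.inr (Or.inr ⟨i', j', h1, h2, rfl⟩)

theorem to_u4 {x : Fin I.u} (h : Arc I v (u4 x)) :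
    ∃ i t j, I.entry i j = x ∧ v = a i t j := by
  cases h with
  | au4 i t j _ => exact ⟨i, t, j, rfl, rfl⟩

theorem to_u1_zero {x : Fin I.u} (hx : x.val = 0) (h : Arc I v (u1 x)) : v = conn2 := by
  cases h with
  | conn2u1 => rfl
  | u4u1 i _ h => omega

theorem to_u1_succ {x y : Fin I.u} (hx : x.val + 1 = y.val) (h : Arc I v (u1 y)) : v = u4 x := by
  cases h with
  | conn2u1 _ h => omega
  | u4u1 i _ h => congr 1; ext; omega

theorem to_s4 {i : Fin I.s} (h : Arc I v (s4 i)) : v = s3 i ∨ v = s5 i := by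
  cases h <;> simp

theorem of_s4 {i : Fin I.s} (h : Arc I (s4 i) w) : w = s3 i ∨ w = s5 i := by
  cases h <;> simp

theorem to_s3 {i : Fin I.s} (h : Arc I v (s3 i)) : v = s4 i ∨ ∃ j, v = c i false j := by
  cases h <;> simp

theorem to_s5 {i : Fin I.s} (h : Arc I v (s5 i)) : v = s4 i ∨ ∃ j, v = c i true j := by
  cases h <;> simp

theorem of_s3 {i : Fin I.s} (h : Arc I (s3 i) w) : w = s4 i ∨ ∃ j, w = a i false j := by
  cases h <;> simp

theorem of_s5 {i : Fin I.s} (h : Arc I (s5 i) w) : w = s4 i ∨ ∃ j, w = a i true j := by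
  cases h <;> simp

end Arc

/-- A cover of the vertices by directed cycles of length at least three, given by the map from
each vertex to the next one. -/
structure IsCycleCover (I : SSP) (σ : Equiv.Perm I.Vertex) : Prop where
  arc : ∀ v, I.Arc v (σ v)
  ne : ∀ v, σ (σ v) ≠ v

namespace IsCycleCover

variable {σ : Equiv.Perm I.Vertex} (hσ : IsCycleCover I σ)

include hσ

theorem arc_symm (v : I.Vertex) : I.Arc (σ.symm v) v := by
  simpa using hσ.arc (σ.symm v)

theorem ne_of_apply_eq {v w : I.Vertex} (h : σ v = w) : σ w ≠ v := h ▸ hσ.ne v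

/-- Whichever of `u2 x`, `u3 x` is not the successor of `u1 x` has only its partner left as a
predecessor. -/
theorem exists_lastVertex (x : Fin I.u) :
    ∃ t, σ (u1 x) = lastVertex (!t) x ∧ σ (lastVertex (!t) x) = lastVertex t x := by
  obtain ⟨t, ht⟩ := (hσ.arc (u1 x)).of_u1
  refine ⟨!t, by simpa using ht, ?_⟩
  obtain h | h := (hσ.arc_symm (lastVertex (!t) x)).to_lastVertex
  · rw [Equiv.symm_apply_eq, ht] at h
    cases t <;> simp at h
  · rw [Equiv.symm_apply_eq] at h
    rw [h]

/-- Whether `x` is put in the first part, i.e. whether `v^{U,x}_2` directly follows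
`v^{U,x}_3`. -/
noncomputable def side (x : Fin I.u) : Bool := (hσ.exists_lastVertex x).choose

theorem apply_u1 (x : Fin I.u) : σ (u1 x) = lastVertex (!hσ.side x) x :=
  (hσ.exists_lastVertex x).choose_spec.1

theorem apply_lastVertex_not (x : Fin I.u) :
    σ (lastVertex (!hσ.side x) x) = lastVertex (hσ.side x) x :=
  (hσ.exists_lastVertex x).choose_spec.2

/-- All arcs at `b` join it to `a` or `c`, and entering and leaving by the same neighbour would be a
2-cycle. -/
theorem forward_or_backward (i : Fin I.s) (t : Bool) (j : Fin (I.k i)) :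
    (σ (a i t j) = b i t j ∧ σ (b i t j) = c i t j) ∨
      (σ (c i t j) = b i t j ∧ σ (b i t j) = a i t j) := by
  obtain h | h := (hσ.arc_symm (b i t j)).to_b <;> rw [Equiv.symm_apply_eq] at h <;>
    obtain h' | h' := (hσ.arc (b i t j)).of_b
  · exact absurd h' (hσ.ne_of_apply_eq h.symm)
  · exact Or.inl ⟨h.symm, h'⟩
  · exact Or.inr ⟨h.symm, h'⟩
  · exact absurd h' (hσ.ne_of_apply_eq h.symm)

/-- A backward run needs `c` to be entered from outside the triple. The vertex `lastVertex t` cannot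
do it, since it leads to its partner; nor can `a` of an earlier set, since by induction that triple
is forward and its `a` leads to `b`. -/
theorem forward {i : Fin I.s} {t : Bool} {j : Fin (I.k i)} (ht : hσ.side (I.entry i j) = !t) :
    σ (a i t j) = b i t j ∧ σ (b i t j) = c i t j := by
  obtain ⟨n, hn⟩ : ∃ n, i.val = n := ⟨_, rfl⟩
  induction n using Nat.strong_induction_on generalizing i with
  | _ n ih =>
    refine (hσ.forward_or_backward i t j).resolve_right fun ⟨hc, hb⟩ => ?_
    obtain h | ⟨-, h⟩ | ⟨i', j', hi, he, h⟩ := (hσ.arc_symm (c i t j)).to_c <;>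
      rw [Equiv.symm_apply_eq] at h
    · rw [← h] at hb; cases hb
    · have := hσ.apply_lastVertex_not (I.entry i j)
      rw [ht, Bool.not_not, ← h] at this
      cases t <;> cases this
    · have := (ih i'.val (by omega) (by rw [he, ht]) rfl).1
      rw [← h] at this; cases this

theorem apply_lastVertex (x : Fin I.u) :
    ∃ i j, I.entry i j = x ∧ (∀ i' < i, x ∉ I.S i') ∧
      σ (lastVertex (hσ.side x) x) = c i (hσ.side x) j := by
  refine (hσ.arc _).of_lastVertex.resolve_left fun h => ?_
  exact hσ.ne_of_apply_eq (hσ.apply_lastVertex_not x) h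

/-- The triples of the side on which an element is put are traversed backward, and they are
reached from the component of the element; `f` is a numbering of the vertices along the cycles
that starts afresh only at `v^{U,1}_1`. -/
theorem backward (f : I.Vertex → ℕ) (hf : ∀ v, (∀ x : Fin I.u, x.val = 0 → σ v ≠ u1 x) →
      f v < f (σ v)) {i : Fin I.s} {j : Fin (I.k i)} {x : Fin I.u} (hx : I.entry i j = x) :
    σ (c i (hσ.side x) j) = b i (hσ.side x) j ∧ σ (b i (hσ.side x) j) = a i (hσ.side x) j ∧
      f (u1 x) < f (a i (hσ.side x) j) := by
  set t := hσ.side x with ht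
  -- It is enough to bound `f` where the triple is entered; two more steps lead from `c` to `a`.
  suffices H : σ (c i t j) = b i t j ∧ σ (b i t j) = a i t j ∧ f (u1 x) < f (c i t j) by
    obtain ⟨h1, h2, h3⟩ := H
    refine ⟨h1, h2, h3.trans ?_⟩
    have e1 := hf (c i t j) (by simp [h1])
    have e2 := hf (b i t j) (by simp [h2])
    rw [h1] at e1; rw [h2] at e2
    exact e1.trans e2
  obtain ⟨n, hn⟩ : ∃ n, i.val = n := ⟨_, rfl⟩
  induction n using Nat.strong_induction_on generalizing i with
  | _ n ih =>
    obtain hl | hl : (∀ i' < i, x ∉ I.S i') ∨ ∃ i' < i, x ∈ I.S i' := by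
      by_cases h : ∃ i' < i, x ∈ I.S i'
      · exact Or.inr h
      · exact Or.inl fun i' hi hx => h ⟨i', hi, hx⟩
    · obtain ⟨i₀, j₀, h0, hmin, hs⟩ := hσ.apply_lastVertex x
      have hi : i₀ = i := by
        apply le_antisymm
        · by_contra! hlt
          exact hmin i hlt (hx ▸ entry_mem i j)
        · by_contra! hlt
          exact hl i₀ hlt (h0 ▸ entry_mem i₀ j₀)
      subst hi
      obtain rfl : j₀ = j := entry_injective i₀ (h0.trans hx.symm)
      rw [← ht] at hs
      -- In a forward run `c` would have two predecessors, `b` and `lastVertex t x`.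
      obtain ⟨h1, h2⟩ := (hσ.forward_or_backward i₀ t j₀).resolve_left fun ⟨_, h2⟩ => by
        have := σ.injective (hs.trans h2.symm)
        revert this; cases t <;> simp
      refine ⟨h1, h2, ?_⟩
      have e1 := hf (u1 x) (by rw [hσ.apply_u1]; cases hσ.side x <;> simp)
      have e2 := hf (lastVertex (!t) x) (by
        rw [ht, hσ.apply_lastVertex_not]; cases hσ.side x <;> simp)
      have e3 := hf (lastVertex t x) (by rw [hs]; simp)
      rw [hσ.apply_u1, ← ht] at e1
      rw [ht, hσ.apply_lastVertex_not, ← ht] at e2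
      rw [hs] at e3
      exact e1.trans (e2.trans e3)
    · obtain ⟨p, ⟨hpi, hpx⟩, hmax⟩ : ∃ p, (p < i ∧ x ∈ I.S p) ∧
          ∀ m, p < m → m < i → x ∉ I.S m := by
        obtain ⟨p, hp⟩ := (Set.toFinite {p | p < i ∧ x ∈ I.S p}).exists_maximal hl
        exact ⟨p, hp.1, fun m h1 h2 h3 => absurd (hp.2 ⟨h2, h3⟩ h1.le) (not_le.2 h1)⟩
      obtain ⟨q, hq⟩ := exists_entry_eq hpx
      obtain ⟨h1, h2, h3⟩ := ih p.val (by omega) hq rfl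
      have ha : f (u1 x) < f (a p t q) := by
        have e1 := hf (c p t q) (by simp [h1])
        have e2 := hf (b p t q) (by simp [h2])
        rw [h1] at e1; rw [h2] at e2
        exact h3.trans (e1.trans e2)
      have hnext : σ (a p t q) = c i t j := by
        obtain h | ⟨h, -⟩ | ⟨i', j', hi, he, hb, h⟩ := (hσ.arc (a p t q)).of_a
        · exact absurd h (hσ.ne_of_apply_eq h2)
        · exact absurd (hq ▸ hx ▸ entry_mem i j) (h i hpi)
        · obtain rfl : i' = i := by
            rw [hq] at hb he
            apply le_antisymm
            · by_contra! hlt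
              exact hb i hpi hlt (hx ▸ entry_mem i j)
            · by_contra! hlt
              exact hmax i' hi hlt (he ▸ entry_mem i' j')
          obtain rfl : j' = j := entry_injective i' (he.symm.trans (hq.trans hx.symm))
          exact h
      obtain ⟨h1', h2'⟩ := (hσ.forward_or_backward i t j).resolve_left fun ⟨_, h⟩ => by
        have := σ.injective (hnext.trans h.symm)
        cases this
      refine ⟨h1', h2', ha.trans ?_⟩
      have := hf (a p t q) (by rw [hnext]; simp)
      rwa [hnext] at this

/-- Going back from `u1 y`: it is entered only from `u4 x`, and that only from an `a` of some triple
of `x`. This `a` does not lead to `b`, so the triple is not forward and lies in part `side x`, where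
`backward` applies. -/
theorem lt_of_succ (f : I.Vertex → ℕ) (hf : ∀ v, (∀ x : Fin I.u, x.val = 0 → σ v ≠ u1 x) →
      f v < f (σ v)) {x y : Fin I.u} (hxy : x.val + 1 = y.val) : f (u1 x) < f (u1 y) := by
  have h4 := (hσ.arc_symm (u1 y)).to_u1_succ hxy
  rw [Equiv.symm_apply_eq] at h4
  have e4 := hf (u4 x) (by rw [← h4]; rintro z hz ⟨⟩; omega)
  rw [← h4] at e4
  refine lt_trans ?_ e4
  obtain ⟨i, t, j, hx, ha⟩ := (hσ.arc_symm (u4 x)).to_u4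
  rw [Equiv.symm_apply_eq] at ha
  have e := hf (a i t j) (by rw [← ha]; simp)
  rw [← ha] at e
  refine lt_trans ?_ e
  obtain rfl : t = hσ.side x := by
    by_contra hne
    have := (hσ.forward (i := i) (t := t) (j := j) (by rw [hx]; revert hne; cases t <;> simp)).1
    rw [← ha] at this; cases this
  exact (hσ.backward f hf hx).2.2

/-- The elements of the universe are passed in ascending order. -/
theorem strictMono (f : I.Vertex → ℕ) (hf : ∀ v, (∀ x : Fin I.u, x.val = 0 → σ v ≠ u1 x) →
      f v < f (σ v)) : StrictMono fun x => f (u1 x) := by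
  intro x y hxy
  obtain ⟨n, hn⟩ : ∃ n, y.val = x.val + n + 1 := ⟨y.val - x.val - 1, by
    have : x.val < y.val := hxy
    omega⟩
  induction n generalizing y with
  | zero => exact hσ.lt_of_succ f hf hn.symm
  | succ n ih =>
    have h := ih (y := ⟨x.val + n + 1, by omega⟩) (by simp [Fin.lt_def]) rfl
    exact h.trans (hσ.lt_of_succ f hf hn.symm)

/-- A `c` that does not lead to its `b` rules out a backward run; the next lemma is the mirror image
at `a`. -/
theorem side_of_apply_c (f : I.Vertex → ℕ) (hf : ∀ v, (∀ x : Fin I.u, x.val = 0 → σ v ≠ u1 x) →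
      f v < f (σ v)) {i : Fin I.s} {t : Bool} {j : Fin (I.k i)} {v : I.Vertex}
    (h : σ (c i t j) = v) (hv : v ≠ b i t j) : hσ.side (I.entry i j) = !t := by
  by_contra hne
  obtain rfl : t = hσ.side (I.entry i j) := by revert hne; cases t <;> simp
  exact hv (h.symm.trans (hσ.backward f hf rfl).1)

theorem side_of_apply_eq_a (f : I.Vertex → ℕ)
    (hf : ∀ v, (∀ x : Fin I.u, x.val = 0 → σ v ≠ u1 x) → f v < f (σ v))
    {i : Fin I.s} {t : Bool} {j : Fin (I.k i)} {v : I.Vertex}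
    (h : σ v = a i t j) (hv : v ≠ b i t j) : hσ.side (I.entry i j) = !t := by
  by_contra hne
  obtain rfl : t = hσ.side (I.entry i j) := by revert hne; cases t <;> simp
  exact hv (σ.injective (h.trans (hσ.backward f hf rfl).2.1.symm))

/-- Every set of the family contains elements of both sides. -/
theorem exists_side_eq (f : I.Vertex → ℕ)
    (hf : ∀ v, (∀ x : Fin I.u, x.val = 0 → σ v ≠ u1 x) → f v < f (σ v)) (i : Fin I.s) (t : Bool) :
    ∃ x ∈ I.S i, hσ.side x = t := by
  suffices h : (∃ j, hσ.side (I.entry i j) = true) ∧ ∃ j, hσ.side (I.entry i j) = false by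
    obtain ⟨⟨j, hj⟩, j', hj'⟩ := h
    cases t
    exacts [⟨_, entry_mem i j', hj'⟩, ⟨_, entry_mem i j, hj⟩]
  -- The detour runs either `s3`, `s4`, `s5` or the reverse. It is entered from a `c` in one part
  -- and left to an `a` in the other, and both triples are forward.
  obtain h | h := (hσ.arc_symm (s4 i)).to_s4 <;> rw [Equiv.symm_apply_eq] at h <;>
    have h' := hσ.ne_of_apply_eq h.symm
  · have h5 := (hσ.arc (s4 i)).of_s4.resolve_left h'
    obtain h3 | ⟨j, h3⟩ := (hσ.arc_symm (s3 i)).to_s3 <;> rw [Equiv.symm_apply_eq] at h3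
    · exact absurd h3.symm h'
    obtain h6 | ⟨j', h6⟩ := (hσ.arc (s5 i)).of_s5
    · exact absurd h6 (hσ.ne_of_apply_eq h5)
    exact ⟨⟨j, hσ.side_of_apply_c f hf h3.symm (by simp)⟩,
      ⟨j', hσ.side_of_apply_eq_a f hf h6 (by simp)⟩⟩
  · have h5 := (hσ.arc (s4 i)).of_s4.resolve_right h'
    obtain h3 | ⟨j, h3⟩ := (hσ.arc_symm (s5 i)).to_s5 <;> rw [Equiv.symm_apply_eq] at h3
    · exact absurd h3.symm h'
    obtain h6 | ⟨j', h6⟩ := (hσ.arc (s3 i)).of_s3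
    · exact absurd h6 (hσ.ne_of_apply_eq h5)
    exact ⟨⟨j', hσ.side_of_apply_eq_a f hf h6 (by simp)⟩,
      ⟨j, hσ.side_of_apply_c f hf h3.symm (by simp)⟩⟩

end IsCycleCover

end SSP

/-! ### Hamiltonian cycles as permutations. -/

theorem IsHamiltonianCycle.rotate {V : Type*} {G : Digraph V} {l : List V}
    (h : IsHamiltonianCycle G l) (n : ℕ) : IsHamiltonianCycle G (l.rotate n) := by
  obtain ⟨h1, h2, h3⟩ := h
  refine ⟨List.nodup_rotate.2 h1, fun v => List.mem_rotate.2 (h2 v), fun m hm => ?_⟩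
  have hl : 0 < l.length := by
    rw [List.length_rotate] at hm; omega
  simp only [List.getElem_rotate, List.length_rotate]
  convert h3 ((m + n) % l.length) (Nat.mod_lt _ hl) using 2
  simp only [Nat.mod_add_mod, Nat.add_right_comm]

theorem IsHamiltonianCycle.adj_formPerm {V : Type*} [DecidableEq V] {G : Digraph V} {l : List V}
    (h : IsHamiltonianCycle G l) (v : V) : G.Adj v (l.formPerm v) := by
  obtain ⟨n, hn, rfl⟩ := List.getElem_of_mem (h.2.1 v)
  rw [List.formPerm_apply_getElem _ h.1]
  exact h.2.2 n hn

/-- Supplies the numbering `f` of the cycle-cover lemmas: positions grow except at the wrap to the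
first entry. -/
theorem List.Nodup.idxOf_formPerm {V : Type*} [DecidableEq V] {v w : V} {l : List V}
    (h : (w :: l).Nodup) (hv : v ∈ w :: l) (hne : (w :: l).formPerm v ≠ w) :
    (w :: l).idxOf ((w :: l).formPerm v) = (w :: l).idxOf v + 1 := by
  obtain ⟨n, hn, rfl⟩ := List.getElem_of_mem hv
  rw [List.formPerm_apply_getElem _ h] at hne ⊢
  have hn' : n + 1 < (w :: l).length := by
    by_contra hlt
    have : n + 1 = (w :: l).length := by omega
    simp [this] at hne
  rw [h.idxOf_getElem, h.idxOf_getElem, Nat.mod_eq_of_lt hn']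

theorem List.Nodup.formPerm_formPerm_ne {V : Type*} [DecidableEq V] {v : V} {l : List V}
    (h : l.Nodup) (hv : v ∈ l) (hl : 2 < l.length) : l.formPerm (l.formPerm v) ≠ v := by
  obtain ⟨n, hn, rfl⟩ := List.getElem_of_mem hv
  rw [List.formPerm_apply_getElem _ h, List.formPerm_apply_getElem _ h, Ne, h.getElem_inj_iff,
    Nat.mod_add_mod]
  intro h2
  -- A return after two steps would make the length divide 2.
  have h3 : (n + 1 + 1) ≡ n + 0 [MOD l.length] := by
    rw [Nat.ModEq, h2, Nat.add_zero, Nat.mod_eq_of_lt hn]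
  have h4 := Nat.le_of_dvd (by norm_num)
    ((Nat.modEq_zero_iff_dvd (n := l.length) (a := 2)).1 (Nat.ModEq.add_left_cancel' n h3))
  omega

/-! ### The partition of a Hamiltonian cycle is a solution. -/

namespace SSP

variable {I : SSP}

open Vertex

section Tour

variable {hu : 0 < I.u} {l : List I.Vertex} (h : IsHamiltonianCycle I.graph l)

include h

theorem isHamiltonianCycle_tour : IsHamiltonianCycle I.graph (I.tour hu l) := h.rotate _

theorem tour_eq_cons : ∃ r, I.tour hu l = u1 ⟨0, hu⟩ :: r := by
  have hlt := List.idxOf_lt_length_of_mem (h.2.1 (u1 ⟨0, hu⟩))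
  have h0 : 0 < (I.tour hu l).length := by rw [tour, List.length_rotate]; omega
  have : (I.tour hu l)[0] = u1 ⟨0, hu⟩ := by
    simp [tour, List.getElem_rotate, Nat.mod_eq_of_lt hlt]
  obtain ⟨v, r, hr⟩ := List.exists_cons_of_length_pos h0
  refine ⟨r, ?_⟩
  simp only [hr, List.getElem_cons_zero] at this
  rw [hr, this]

theorem isCycleCover_tour : IsCycleCover I (I.tour hu l).formPerm := by
  have hT := isHamiltonianCycle_tour (hu := hu) h
  refine ⟨hT.adj_formPerm, fun v => hT.1.formPerm_formPerm_ne (hT.2.1 v) ?_⟩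
  -- Three distinct vertices suffice to exclude 2-cycles.
  have : ([u1 ⟨0, hu⟩, u2 ⟨0, hu⟩, u3 ⟨0, hu⟩] : List I.Vertex).Subperm (I.tour hu l) :=
    List.Nodup.subperm (by simp) fun v _ => hT.2.1 v
  have := this.length_le
  simp only [List.length_cons, List.length_nil] at this
  omega

theorem idxOf_tour_formPerm {v : I.Vertex}
    (hv : ∀ x : Fin I.u, x.val = 0 → (I.tour hu l).formPerm v ≠ u1 x) :
    (I.tour hu l).idxOf ((I.tour hu l).formPerm v) = (I.tour hu l).idxOf v + 1 := by
  have hT := isHamiltonianCycle_tour (hu := hu) h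
  have hv := hv ⟨0, hu⟩ rfl
  have hm := hT.2.1 v
  have hn := hT.1
  obtain ⟨r, hr⟩ := tour_eq_cons (hu := hu) h
  rw [hr] at hv hm hn ⊢
  exact hn.idxOf_formPerm hm hv

theorem lt_idxOf_tour_formPerm (v : I.Vertex)
    (hv : ∀ x : Fin I.u, x.val = 0 → (I.tour hu l).formPerm v ≠ u1 x) :
    (I.tour hu l).idxOf v < (I.tour hu l).idxOf ((I.tour hu l).formPerm v) := by
  rw [idxOf_tour_formPerm h hv]; exact Nat.lt_succ_self _

theorem idxOf_lastVertex_lt (x : Fin I.u) :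
    (I.tour hu l).idxOf (lastVertex (!(isCycleCover_tour (hu := hu) h).side x) x) <
      (I.tour hu l).idxOf (lastVertex ((isCycleCover_tour (hu := hu) h).side x) x) := by
  have hσ := isCycleCover_tour (hu := hu) h
  have := lt_idxOf_tour_formPerm (hu := hu) h (lastVertex (!hσ.side x) x) fun y _ => by
    rw [hσ.apply_lastVertex_not]; cases hσ.side x <;> simp
  rwa [hσ.apply_lastVertex_not] at this

theorem mem_firstPart {x : Fin I.u} :
    x ∈ I.firstPart hu l ↔ (isCycleCover_tour (hu := hu) h).side x = true := by
  have := idxOf_lastVertex_lt (hu := hu) h x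
  rw [firstPart, Finset.mem_filter_univ]
  revert this
  cases (isCycleCover_tour (hu := hu) h).side x <;> simp <;> omega

theorem mem_secondPart {x : Fin I.u} :
    x ∈ I.secondPart hu l ↔ (isCycleCover_tour (hu := hu) h).side x = false := by
  have := idxOf_lastVertex_lt (hu := hu) h x
  rw [secondPart, Finset.mem_filter_univ]
  revert this
  cases (isCycleCover_tour (hu := hu) h).side x <;> simp <;> omega

/-- The partition read off from a Hamiltonian cycle is a solution. -/
theorem isSolution_of_isHamiltonianCycle (hI : I.SimpleForm) :
    I.IsSolution (I.firstPart hu l) (I.secondPart hu l) := by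
  have hσ := isCycleCover_tour (hu := hu) h
  have hex := hσ.exists_side_eq _ (lt_idxOf_tour_formPerm h)
  -- At least one set exists, and its elements witness that both parts are non-empty.
  obtain ⟨i₀, -⟩ := hI.covered ⟨0, hu⟩
  refine ⟨?_, ?_, ?_, ?_, fun i => ⟨fun hs => ?_, fun hs => ?_⟩⟩
  · obtain ⟨x, -, hx⟩ := hex i₀ true
    exact ⟨x, (mem_firstPart h).2 hx⟩
  · obtain ⟨x, -, hx⟩ := hex i₀ false
    exact ⟨x, (mem_secondPart h).2 hx⟩
  · refine Finset.disjoint_left.2 fun x hx hx' => ?_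
    rw [mem_firstPart h] at hx
    rw [mem_secondPart h, hx] at hx'
    cases hx'
  · ext x
    simp [mem_firstPart h, mem_secondPart h]
  · obtain ⟨x, hx, hx'⟩ := hex i false
    simpa [mem_firstPart h, hx'] using hs hx
  · obtain ⟨x, hx, hx'⟩ := hex i true
    simpa [mem_secondPart h, hx'] using hs hx

end Tour

end SSP

/-! ### Counting vertices and arcs. -/

namespace SSP

variable {I : SSP}

open Vertex

/-- The vertices, sorted by kind. -/
def vertexEquiv (I : SSP) : I.Vertex ≃
    ((Fin I.u ⊕ Fin I.u) ⊕ (Fin I.u ⊕ Fin I.u)) ⊕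
    ((Fin I.s ⊕ Fin I.s) ⊕ (Fin I.s ⊕ Fin I.s ⊕ Fin I.s)) ⊕
    ((Σ i, Bool × Fin (I.k i)) ⊕ (Σ i, Bool × Fin (I.k i)) ⊕ (Σ i, Bool × Fin (I.k i))) ⊕
    (Unit ⊕ Unit) where
  toFun
    | u1 x => .inl (.inl (.inl x))
    | u2 x => .inl (.inl (.inr x))
    | u3 x => .inl (.inr (.inl x))
    | u4 x => .inl (.inr (.inr x))
    | s1 i => .inr (.inl (.inl (.inl i)))
    | s2 i => .inr (.inl (.inl (.inr i)))
    | s3 i => .inr (.inl (.inr (.inl i)))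
    | s4 i => .inr (.inl (.inr (.inr (.inl i))))
    | s5 i => .inr (.inl (.inr (.inr (.inr i))))
    | a i t j => .inr (.inr (.inl (.inl ⟨i, t, j⟩)))
    | b i t j => .inr (.inr (.inl (.inr (.inl ⟨i, t, j⟩))))
    | c i t j => .inr (.inr (.inl (.inr (.inr ⟨i, t, j⟩))))
    | conn1 => .inr (.inr (.inr (.inl ())))
    | conn2 => .inr (.inr (.inr (.inr ())))
  invFun
    | .inl (.inl (.inl x)) => u1 x
    | .inl (.inl (.inr x)) => u2 x
    | .inl (.inr (.inl x)) => u3 x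
    | .inl (.inr (.inr x)) => u4 x
    | .inr (.inl (.inl (.inl i))) => s1 i
    | .inr (.inl (.inl (.inr i))) => s2 i
    | .inr (.inl (.inr (.inl i))) => s3 i
    | .inr (.inl (.inr (.inr (.inl i)))) => s4 i
    | .inr (.inl (.inr (.inr (.inr i)))) => s5 i
    | .inr (.inr (.inl (.inl ⟨i, t, j⟩))) => a i t j
    | .inr (.inr (.inl (.inr (.inl ⟨i, t, j⟩)))) => b i t j
    | .inr (.inr (.inl (.inr (.inr ⟨i, t, j⟩)))) => c i t j
    | .inr (.inr (.inr (.inl ()))) => conn1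
    | .inr (.inr (.inr (.inr ()))) => conn2
  left_inv v := by cases v <;> rfl
  right_inv v := by
    rcases v with ((_ | _) | (_ | _)) | ((_ | _) | (_ | _ | _)) | (_ | _ | _) | (_ | _) <;> rfl

instance : Fintype I.Vertex := Fintype.ofEquiv _ (vertexEquiv I).symm

theorem sum_vertex (F : I.Vertex → ℕ) :
    ∑ v, F v = ∑ x, (F (u1 x) + F (u2 x) + F (u3 x) + F (u4 x)) +
      ∑ i, (F (s1 i) + F (s2 i) + F (s3 i) + F (s4 i) + F (s5 i)) +
      ∑ i, ∑ t, ∑ j, (F (a i t j) + F (b i t j) + F (c i t j)) + F conn1 + F conn2 := by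
  rw [← Equiv.sum_comp (vertexEquiv I).symm F]
  simp only [Fintype.sum_sum_type, Fintype.sum_sigma, Fintype.sum_prod_type, vertexEquiv,
    Equiv.coe_fn_symm_mk, Finset.sum_add_distrib, Finset.univ_unique, Finset.sum_singleton]
  ring

theorem card_vertex (I : SSP) :
    Fintype.card I.Vertex = 4 * I.u + 5 * I.s + 6 * I.totalCard + 2 := by
  rw [← Finset.card_univ, Finset.card_eq_sum_ones, sum_vertex]
  simp [totalCard, Finset.mul_sum, ← mul_assoc, mul_comm]

namespace SimpleForm

variable (hI : I.SimpleForm) (hu : 0 < I.u)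

include hI hu

/-- An empty set would be contained in another set of the family, one that covers an element. -/
theorem k_pos (i : Fin I.s) : 0 < I.k i := by
  by_contra! h
  have he : I.S i = ∅ := Finset.card_eq_zero.1 (Nat.le_zero.1 h)
  obtain ⟨i', hi'⟩ := hI.covered ⟨0, hu⟩
  have hne : i ≠ i' := by
    rintro rfl
    simp [he] at hi'
  exact hI.not_subset i i' hne (by simp [he])

theorem s_pos : 0 < I.s := by
  obtain ⟨i, -⟩ := hI.covered ⟨0, hu⟩
  exact i.pos

end SimpleForm

theorem exists_first (hI : I.SimpleForm) (x : Fin I.u) :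
    ∃ i j, I.entry i j = x ∧ ∀ i' < i, x ∉ I.S i' := by
  obtain ⟨i, hi⟩ := (Set.toFinite {i | x ∈ I.S i}).exists_minimal (hI.covered x)
  obtain ⟨j, hj⟩ := exists_entry_eq hi.1
  exact ⟨i, j, hj, fun i' h h' => absurd (hi.2 h' h.le) (not_le.2 h)⟩

theorem exists_next (i : Fin I.s) (x : Fin I.u) : (∀ i' > i, x ∉ I.S i') ∨
    ∃ i' j', i < i' ∧ I.entry i' j' = x ∧ ∀ m, i < m → m < i' → x ∉ I.S m := by
  by_cases h : ∃ i' > i, x ∈ I.S i'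
  · right
    obtain ⟨i', hi'⟩ := (Set.toFinite {i' | i' > i ∧ x ∈ I.S i'}).exists_minimal h
    obtain ⟨j, hj⟩ := exists_entry_eq hi'.1.2
    exact ⟨i', j, hi'.1.1, hj, fun m h1 h2 h3 =>
      absurd (hi'.2 ⟨h1, h3⟩ h2.le) (not_le.2 h2)⟩
  · left
    exact fun i' hi hx => h ⟨i', hi, hx⟩

/-- The number of arcs that leave a vertex. -/
noncomputable def outDegree (v : I.Vertex) : ℕ := {w | I.Arc v w}.ncard

theorem outDegree_eq_two {v w₁ w₂ : I.Vertex} (hne : w₁ ≠ w₂)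
    (h : ∀ w, I.Arc v w ↔ w = w₁ ∨ w = w₂) : outDegree v = 2 := by
  rw [outDegree, ← Set.ncard_pair hne]
  congr 1
  ext w
  exact h w

theorem outDegree_eq_one {v w₁ : I.Vertex} (h : ∀ w, I.Arc v w ↔ w = w₁) : outDegree v = 1 := by
  rw [outDegree, ← Set.ncard_singleton w₁]
  congr 1
  ext w
  exact h w

theorem outDegree_of_injective {v : I.Vertex} {n : ℕ} {g : Fin n → I.Vertex}
    (hg : Function.Injective g) (h : ∀ w, I.Arc v w ↔ ∃ j, g j = w) : outDegree v = n := by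
  have : {w | I.Arc v w} = Set.range g := by
    ext w
    exact h w
  rw [outDegree, this, ← Nat.card_coe_set_eq, Nat.card_range_of_injective hg, Nat.card_fin]

theorem outDegree_u1 (x : Fin I.u) : outDegree (u1 x) = 2 :=
  outDegree_eq_two (w₁ := u2 x) (w₂ := u3 x) (by simp) fun w =>
    ⟨fun h => by cases h <;> simp, by rintro (rfl | rfl) <;> constructor⟩

theorem outDegree_lastVertex (hI : I.SimpleForm) (t : Bool) (x : Fin I.u) :
    outDegree (lastVertex t x) = 2 := by
  obtain ⟨i, j, rfl, hf⟩ := exists_first hI x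
  refine outDegree_eq_two (w₁ := lastVertex (!t) (I.entry i j)) (w₂ := c i t j)
    (by cases t <;> simp) fun w => ⟨fun h => ?_, ?_⟩
  · obtain rfl | ⟨i', j', he, hf', rfl⟩ := h.of_lastVertex
    · exact Or.inl rfl
    · right
      obtain rfl : i' = i := by
        apply le_antisymm
        · by_contra! hlt
          exact hf' i hlt (entry_mem i j)
        · by_contra! hlt
          exact hf i' hlt (he ▸ entry_mem i' j')
      rw [entry_injective _ he]
  · rintro (rfl | rfl)
    · cases t <;> constructor
    · cases t
      · exact .u3c i j hf
      · exact .u2c i j hf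

theorem outDegree_u4 (x : Fin I.u) : outDegree (u4 x) = 1 := by
  by_cases hx : x.val + 1 = I.u
  · refine outDegree_eq_one (w₁ := conn1) fun w => ⟨fun h => ?_, ?_⟩
    · cases h with
      | u4conn1 => rfl
      | u4u1 _ y h => omega
    · rintro rfl
      exact .u4conn1 x hx
  · refine outDegree_eq_one (w₁ := u1 ⟨x + 1, by omega⟩) fun w => ⟨fun h => ?_, ?_⟩
    · cases h with
      | u4conn1 _ h => exact absurd h hx
      | u4u1 _ y h => congr 1; ext; exact h.symm
    · rintro rfl
      exact .u4u1 x _ rfl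

theorem outDegree_s1 {i : Fin I.s} (hk : 0 < I.k i) : outDegree (s1 i) = 2 := by
  refine outDegree_eq_two (w₁ := a i false ⟨0, hk⟩) (w₂ := a i true ⟨0, hk⟩) (by simp) fun w =>
    ⟨fun h => ?_, by rintro (rfl | rfl) <;> exact .s1a _ _ _ rfl⟩
  cases h with
  | s1a _ t j h =>
    obtain rfl : j = ⟨0, hk⟩ := Fin.ext h
    cases t <;> simp

theorem outDegree_s2 (i : Fin I.s) : outDegree (s2 i) = 1 := by
  by_cases hi : i.val + 1 = I.s
  · refine outDegree_eq_one (w₁ := conn2) fun w => ⟨fun h => ?_, ?_⟩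
    · cases h with
      | s2conn2 => rfl
      | s2s1 _ y h => omega
    · rintro rfl
      exact .s2conn2 i hi
  · refine outDegree_eq_one (w₁ := s1 ⟨i + 1, by omega⟩) fun w => ⟨fun h => ?_, ?_⟩
    · cases h with
      | s2conn2 _ h => exact absurd h hi
      | s2s1 _ y h => congr 1; ext; exact h.symm
    · rintro rfl
      exact .s2s1 i _ rfl

theorem outDegree_s3 {i : Fin I.s} (hk : 0 < I.k i) : outDegree (s3 i) = I.k i := by
  -- No arc leads from `s3` to the first triple, so index 0 is free to stand for the arc to `s4`.
  refine outDegree_of_injective (g := fun j => if j.val = 0 then s4 i else a i false j)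
    (fun j j' h => ?_) fun w => ⟨fun h => ?_, ?_⟩
  · dsimp only at h
    split_ifs at h with h1 h2 h2
    · exact Fin.ext (h1.trans h2.symm)
    · cases h; rfl
  · cases h with
    | s34 => exact ⟨⟨0, hk⟩, by simp⟩
    | s3a _ j h => exact ⟨j, by simp [h.ne']⟩
  · rintro ⟨j, rfl⟩
    split_ifs with h
    · exact .s34 i
    · exact .s3a i j (Nat.pos_of_ne_zero h)

theorem outDegree_s5 {i : Fin I.s} (hk : 0 < I.k i) : outDegree (s5 i) = I.k i := by
  refine outDegree_of_injective (g := fun j => if j.val = 0 then s4 i else a i true j)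
    (fun j j' h => ?_) fun w => ⟨fun h => ?_, ?_⟩
  · dsimp only at h
    split_ifs at h with h1 h2 h2
    · exact Fin.ext (h1.trans h2.symm)
    · cases h; rfl
  · cases h with
    | s54 => exact ⟨⟨0, hk⟩, by simp⟩
    | s5a _ j h => exact ⟨j, by simp [h.ne']⟩
  · rintro ⟨j, rfl⟩
    split_ifs with h
    · exact .s54 i
    · exact .s5a i j (Nat.pos_of_ne_zero h)

theorem outDegree_s4 (i : Fin I.s) : outDegree (s4 i) = 2 :=
  outDegree_eq_two (w₁ := s3 i) (w₂ := s5 i) (by simp) fun w =>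
    ⟨fun h => h.of_s4, by rintro (rfl | rfl) <;> constructor⟩

theorem outDegree_a (i : Fin I.s) (t : Bool) (j : Fin (I.k i)) : outDegree (a i t j) = 2 := by
  obtain hl | ⟨i', j', hi, he, hb⟩ := exists_next i (I.entry i j)
  · refine outDegree_eq_two (w₁ := b i t j) (w₂ := u4 (I.entry i j)) (by simp) fun w =>
      ⟨fun h => ?_, ?_⟩
    · obtain rfl | ⟨-, rfl⟩ | ⟨i', j', hi, he, -, rfl⟩ := h.of_a
      · exact Or.inl rfl
      · exact Or.inr rfl
      · exact absurd (he ▸ entry_mem i' j') (hl i' hi)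
    · rintro (rfl | rfl)
      exacts [.ab i t j, .au4 i t j hl]
  · refine outDegree_eq_two (w₁ := b i t j) (w₂ := c i' t j') (by simp) fun w =>
      ⟨fun h => ?_, ?_⟩
    · obtain rfl | ⟨hl, rfl⟩ | ⟨i₂, j₂, hi₂, he₂, hb₂, rfl⟩ := h.of_a
      · exact Or.inl rfl
      · exact absurd (he ▸ entry_mem i' j') (hl i' hi)
      · right
        obtain rfl : i' = i₂ := by
          apply le_antisymm
          · by_contra! hlt
            exact hb i₂ hi₂ hlt (he₂ ▸ entry_mem i₂ j₂)
          · by_contra! hlt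
            exact hb₂ i' hi hlt (he ▸ entry_mem i' j')
        rw [entry_injective _ (he.trans he₂)]
    · rintro (rfl | rfl)
      exacts [.ab i t j, .ac i i' t j j' hi he.symm hb]

theorem outDegree_b (i : Fin I.s) (t : Bool) (j : Fin (I.k i)) : outDegree (b i t j) = 2 :=
  outDegree_eq_two (w₁ := a i t j) (w₂ := c i t j) (by simp) fun w =>
    ⟨fun h => h.of_b, by rintro (rfl | rfl) <;> constructor⟩

/-- Before the last position the successors are `b`, both next `a`s and a detour vertex; at the last
only `b` and `s2`. The additive form avoids truncated subtraction in the sum. -/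
theorem outDegree_c (i : Fin I.s) (t : Bool) (j : Fin (I.k i)) :
    outDegree (c i t j) + (if j.val + 1 = I.k i then 2 else 0) = 4 := by
  split_ifs with hj
  · rw [outDegree_eq_two (w₁ := b i t j) (w₂ := s2 i) (by simp) fun w => ⟨fun h => ?_, ?_⟩]
    · cases h with
      | cb => simp
      | cs2 => simp
      | ca _ _ _ _ j' h => omega
      | cs3 _ _ h => omega
      | cs5 _ _ h => omega
    · rintro (rfl | rfl)
      exacts [.cb i t j, .cs2 i t j hj]
  · have hlt : j.val + 1 < I.k i := by omega
    set n : Fin (I.k i) := ⟨j + 1, hlt⟩ with hn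
    have hset : {w | I.Arc (c i t j) w} =
        (({b i t j, a i false n, a i true n, if t then s5 i else s3 i} : Finset I.Vertex) :
          Set I.Vertex) := by
      ext w
      simp only [Set.mem_ofPred_eq, Finset.coe_insert, Finset.coe_singleton, Set.mem_insert_iff,
        Set.mem_singleton_iff]
      constructor
      · intro h
        cases h with
        | cb => simp
        | cs2 _ _ _ h => exact absurd h hj
        | ca _ _ t' _ j' h =>
          obtain rfl : j' = n := Fin.ext h.symm
          cases t' <;> simp
        | cs3 _ _ h => simp
        | cs5 _ _ h => simp
      · rintro (rfl | rfl | rfl | rfl)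
        · exact .cb i t j
        · exact .ca i t false j n rfl
        · exact .ca i t true j n rfl
        · cases t
          · exact .cs3 i j hlt
          · exact .cs5 i j hlt
    rw [outDegree, hset, Set.ncard_coe_finset]
    cases t <;> simp

theorem outDegree_conn1 (hs : 0 < I.s) : outDegree (conn1 : I.Vertex) = 1 := by
  refine outDegree_eq_one (w₁ := s1 ⟨0, hs⟩) fun w => ⟨fun h => ?_, ?_⟩
  · cases h with
    | conn1s1 i h => congr 1; exact Fin.ext h
  · rintro rfl
    exact .conn1s1 _ rfl

theorem outDegree_conn2 (hu : 0 < I.u) : outDegree (conn2 : I.Vertex) = 1 := by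
  refine outDegree_eq_one (w₁ := u1 ⟨0, hu⟩) fun w => ⟨fun h => ?_, ?_⟩
  · cases h with
    | conn2u1 i h => congr 1; exact Fin.ext h
  · rintro rfl
    exact .conn2u1 _ rfl

theorem sum_outDegree_c {i : Fin I.s} (hk : 0 < I.k i) (t : Bool) :
    ∑ j, outDegree (c i t j) + 2 = 4 * I.k i := by
  have h : ∑ j, (outDegree (c i t j) + (if j.val + 1 = I.k i then 2 else 0)) = 4 * I.k i := by
    simp [outDegree_c, mul_comm]
  have h2 : ∑ j : Fin (I.k i), (if j.val + 1 = I.k i then 2 else 0) = 2 := by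
    rw [Finset.sum_eq_single (⟨I.k i - 1, by omega⟩ : Fin (I.k i))]
    · exact if_pos (Nat.sub_add_cancel hk)
    · intro j _ hj
      refine if_neg fun h => hj (Fin.ext ?_)
      simp only
      omega
    · simp
  rw [← h, Finset.sum_add_distrib, h2]

theorem card_arcs (hI : I.SimpleForm) (hu : 0 < I.u) :
    Nat.card {p : I.Vertex × I.Vertex // I.graph.Adj p.1 p.2} =
      7 * I.u + I.s + 18 * I.totalCard + 2 := by
  have hsum : Nat.card {p : I.Vertex × I.Vertex // I.graph.Adj p.1 p.2} =
      ∑ v : I.Vertex, outDegree v := by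
    classical
    have e := Nat.card_congr (Equiv.subtypeProdEquivSigmaSubtype fun v w => I.Arc v w)
    rw [Nat.card_sigma] at e
    exact e
  have h2 : ∀ x : Fin I.u, outDegree (u2 x) = 2 := outDegree_lastVertex hI true
  have h3 : ∀ x : Fin I.u, outDegree (u3 x) = 2 := outDegree_lastVertex hI false
  have hk := hI.k_pos hu
  -- With `k = |S^i|`: `5 + 2k` from `s1` to `s5`, `4k` each from the `a` and the `b`, and `2(4k -
  -- 2)` from the `c`.
  have hset : ∀ i : Fin I.s, (outDegree (s1 i) + outDegree (s2 i) + outDegree (s3 i) +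
      outDegree (s4 i) + outDegree (s5 i)) +
      ∑ t, ∑ j, (outDegree (a i t j) + outDegree (b i t j) + outDegree (c i t j)) =
        18 * (I.S i).card + 1 := by
    intro i
    have ht := sum_outDegree_c (hk i) true
    have hf := sum_outDegree_c (hk i) false
    simp only [outDegree_s1 (hk i), outDegree_s2, outDegree_s3 (hk i), outDegree_s4,
      outDegree_s5 (hk i), outDegree_a, outDegree_b, Finset.sum_add_distrib, Fintype.sum_bool,
      Finset.sum_const, Finset.card_univ, Fintype.card_fin, smul_eq_mul, Fintype.card_bool, k] at ht hf ⊢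
    omega
  rw [hsum, sum_vertex, outDegree_conn1 (hI.s_pos hu), outDegree_conn2 hu, add_assoc (∑ x, _),
    ← Finset.sum_add_distrib, Finset.sum_congr rfl fun i _ => hset i]
  simp only [outDegree_u1, h2, h3, outDegree_u4, Finset.sum_add_distrib, Finset.sum_const,
    Finset.card_univ, Fintype.card_fin, smul_eq_mul, totalCard, ← Finset.mul_sum]
  ring

end SSP

/-! ### Assembling cycles from chains. -/

theorem isHamiltonianCycle_of_isChain {V : Type*} [Fintype V] {G : Digraph V} {l : List V}
    (hc : l.IsChain G.Adj) (hl : ∀ v ∈ l.getLast?, ∀ w ∈ l.head?, G.Adj v w)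
    (hmem : ∀ v, v ∈ l) (hcard : l.length = Fintype.card V) : IsHamiltonianCycle G l := by
  classical
  refine ⟨?_, hmem, fun n hn => ?_⟩
  · rw [← Multiset.coe_nodup, ← Multiset.toFinset_card_eq_card_iff_nodup, Multiset.coe_card, hcard,
      ← Finset.card_univ]
    congr 1
    ext v
    simp [hmem]
  · by_cases h : n + 1 < l.length
    · simp only [Nat.mod_eq_of_lt h]
      exact List.isChain_iff_getElem.1 hc n h
    · obtain rfl : n = l.length - 1 := by omega
      refine hl _ ?_ _ ?_
      · rw [List.getLast?_eq_getElem?, List.getElem?_eq_getElem hn, Option.mem_some_iff]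
      · have : (l.length - 1 + 1) % l.length = 0 := by
          rw [Nat.sub_add_cancel (by omega), Nat.mod_self]
        simp only [this]
        rw [List.head?_eq_getElem?, List.getElem?_eq_getElem (by omega), Option.mem_some_iff]

/-- Used for the sets containing an element: neighbours in that list have no such set between them,
as `Arc.ac` requires. -/
theorem List.Pairwise.isChain_forall_mem {α : Type*} [LinearOrder α] {l : List α}
    (h : l.Pairwise (· < ·)) :
    l.IsChain fun x y => x < y ∧ ∀ z ∈ l, x < z → ¬ z < y := by
  refine List.isChain_iff_getElem.2 fun n hn => ⟨List.pairwise_iff_getElem.1 h _ _ _ _ (by omega),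
    fun z hz h1 h2 => ?_⟩
  obtain ⟨m, hm, rfl⟩ := List.getElem_of_mem hz
  have hs : StrictMono l.get := fun p q hpq => List.pairwise_iff_get.1 h p q hpq
  have h1' : (⟨n, by omega⟩ : Fin l.length) < ⟨m, hm⟩ := hs.lt_iff_lt.1 h1
  have h2' : (⟨m, hm⟩ : Fin l.length) < ⟨n + 1, hn⟩ := hs.lt_iff_lt.1 h2
  rw [Fin.mk_lt_mk] at h1' h2'
  omega

theorem List.isChain_finRange (n : ℕ) :
    (List.finRange n).IsChain fun i j => i.val + 1 = j.val := by
  refine List.isChain_iff_getElem.2 fun m hm => ?_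
  simp

theorem List.isChain_flatMap {α β : Type*} {R : β → β → Prop} {f : α → List β} {l : List α}
    (hne : ∀ x ∈ l, f x ≠ []) (hc : ∀ x ∈ l, (f x).IsChain R)
    (h : l.IsChain fun x y => ∀ v ∈ (f x).getLast?, ∀ w ∈ (f y).head?, R v w) :
    (l.flatMap f).IsChain R := by
  rw [List.flatMap_def, List.isChain_flatten (by simpa using hne)]
  exact ⟨by simpa using hc, (List.isChain_map f).2 h⟩

theorem List.head?_flatMap_finRange {β : Type*} {n : ℕ} {f : Fin n → List β} (hn : 0 < n)
    {v : β} {r : List β} (h : f ⟨0, hn⟩ = v :: r) : ((List.finRange n).flatMap f).head? = some v := by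
  obtain ⟨m, rfl⟩ : ∃ m, n = m + 1 := ⟨n - 1, by omega⟩
  rw [List.finRange_succ, List.flatMap_cons]
  change (f ⟨0, hn⟩ ++ _).head? = _
  rw [h]; rfl

theorem List.getLast?_flatMap_finRange {β : Type*} {n : ℕ} {f : Fin n → List β} (hn : n - 1 < n)
    {v : β} (h : (f ⟨n - 1, hn⟩).getLast? = some v) :
    ((List.finRange n).flatMap f).getLast? = some v := by
  obtain ⟨m, rfl⟩ : ∃ m, n = m + 1 := ⟨n - 1, by omega⟩
  rw [List.finRange_succ_last, List.flatMap_append, List.getLast?_append, List.flatMap_singleton]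
  change (f (Fin.last m)).getLast? = some v at h
  rw [h, Option.some_or]

/-! ### Constructing a Hamiltonian cycle from a solution. -/

namespace SSP

variable {I : SSP}

open Vertex

section Construction

variable (t : Fin I.u → Bool)

/-- The part of the cycle that runs through the component of the set `S^i` for the element
`x`. -/
noncomputable def tripleOf (x : Fin I.u) (i : Fin I.s) : List I.Vertex :=
  if h : x ∈ I.S i then
    [c i (t x) (exists_entry_eq h).choose, b i (t x) (exists_entry_eq h).choose,
      a i (t x) (exists_entry_eq h).choose]
  else []

theorem tripleOf_entry (i : Fin I.s) (j : Fin (I.k i)) : tripleOf t (I.entry i j) i =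
    [c i (t (I.entry i j)) j, b i (t (I.entry i j)) j, a i (t (I.entry i j)) j] := by
  have h := (exists_entry_eq (entry_mem i j)).choose_spec
  rw [tripleOf, dif_pos (entry_mem i j), entry_injective i h]

/-- The sets that contain an element, in ascending order. -/
def occurrences (x : Fin I.u) : List (Fin I.s) := (List.finRange I.s).filter (x ∈ I.S ·)

theorem mem_occurrences {x : Fin I.u} {i : Fin I.s} : i ∈ occurrences x ↔ x ∈ I.S i := by
  simp [occurrences]

theorem exists_of_mem_occurrences {x : Fin I.u} {i : Fin I.s} (h : i ∈ occurrences x) :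
    ∃ j, I.entry i j = x ∧ tripleOf t x i = [c i (t x) j, b i (t x) j, a i (t x) j] := by
  obtain ⟨j, rfl⟩ := exists_entry_eq (mem_occurrences.1 h)
  exact ⟨j, rfl, tripleOf_entry t i j⟩

theorem pairwise_occurrences (x : Fin I.u) : (occurrences x).Pairwise (· < ·) :=
  (List.pairwise_lt_finRange _).filter _

/-- The part of the cycle that visits the backward triples of an element. -/
noncomputable def elemPath (x : Fin I.u) : List I.Vertex := (occurrences x).flatMap (tripleOf t x)

theorem isChain_elemPath (x : Fin I.u) : (elemPath t x).IsChain I.Arc := by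
  refine List.isChain_flatMap (fun i hi => ?_) (fun i hi => ?_) ?_
  · obtain ⟨j, -, h⟩ := exists_of_mem_occurrences t hi
    simp [h]
  · obtain ⟨j, -, h⟩ := exists_of_mem_occurrences t hi
    simpa [h] using ⟨Arc.cb _ _ _, Arc.ba _ _ _⟩
  · have hmem := (pairwise_occurrences x).isChain_forall_mem
    have hc : (occurrences x).IsChain fun i i' => i < i' ∧
        (∀ m ∈ occurrences x, i < m → ¬ m < i') ∧ i ∈ occurrences x ∧ i' ∈ occurrences x := by
      rw [List.isChain_iff_getElem] at hmem ⊢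
      exact fun n hn => ⟨(hmem n hn).1, (hmem n hn).2, List.getElem_mem _, List.getElem_mem _⟩
    refine hc.imp fun i i' ⟨h1, h2, h3, h4⟩ v hv w hw => ?_
    obtain ⟨j, hj, h⟩ := exists_of_mem_occurrences t h3
    obtain ⟨j', hj', h'⟩ := exists_of_mem_occurrences t h4
    simp only [h, h', List.getLast?_cons_cons, List.getLast?_singleton, List.head?_cons,
      Option.mem_some_iff] at hv hw
    subst hv hw
    exact .ac i i' (t x) j j' h1 (hj.trans hj'.symm) fun m hm hm' hx =>
      h2 m (mem_occurrences.2 (hj ▸ hx)) hm hm'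

theorem elemPath_head (x : Fin I.u) : ∀ w ∈ (elemPath t x).head?, Arc I (lastVertex (t x) x) w := by
  intro w hw
  have hs := pairwise_occurrences x
  cases hL : occurrences x with
  | nil => simp [elemPath, hL] at hw
  | cons i L =>
    obtain ⟨j, rfl, h⟩ := exists_of_mem_occurrences t (x := x) (i := i) (by simp [hL])
    simp only [elemPath, hL, List.flatMap_cons, h, List.cons_append, List.head?_cons,
      Option.mem_some_iff] at hw
    subst hw
    have hf : ∀ i' < i, I.entry i j ∉ I.S i' := by
      intro i' hi' hx
      rw [← mem_occurrences, hL, List.mem_cons] at hx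
      rw [hL, List.pairwise_cons] at hs
      obtain rfl | hx := hx
      · exact lt_irrefl _ hi'
      · exact lt_asymm hi' (hs.1 _ hx)
    cases t (I.entry i j)
    exacts [.u3c i j hf, .u2c i j hf]

theorem elemPath_last (x : Fin I.u) : ∀ v ∈ (elemPath t x).getLast?, Arc I v (u4 x) := by
  intro v hv
  have hs := pairwise_occurrences x
  obtain hL | ⟨L, i, hL⟩ := List.eq_nil_or_concat' (occurrences x)
  · simp [elemPath, hL] at hv
  · obtain ⟨j, rfl, h⟩ := exists_of_mem_occurrences t (x := x) (i := i) (by simp [hL])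
    simp [elemPath, hL, h] at hv
    subst hv
    refine .au4 i _ j fun i' hi' hx => ?_
    rw [← mem_occurrences, hL, List.mem_append, List.mem_singleton] at hx
    rw [hL, List.pairwise_append] at hs
    obtain hx | rfl := hx
    · exact lt_asymm hi' (hs.2.2 _ hx i (by simp))
    · exact lt_irrefl _ hi'

theorem elemPath_ne_nil (hI : I.SimpleForm) (x : Fin I.u) : elemPath t x ≠ [] := by
  obtain ⟨i, hi⟩ := hI.covered x
  obtain ⟨j, -, h⟩ := exists_of_mem_occurrences t (mem_occurrences.2 hi)
  intro he
  rw [elemPath, List.flatMap_eq_nil_iff] at he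
  simpa [h] using he i (mem_occurrences.2 hi)

/-- Written with indicators so that summing over `x` and exchanging the sums gives `3c`. -/
theorem length_elemPath (x : Fin I.u) :
    (elemPath t x).length = 3 * ∑ i, if x ∈ I.S i then 1 else 0 := by
  have : ∀ i ∈ occurrences x, (tripleOf t x i).length = 3 := by
    intro i hi
    obtain ⟨j, -, h⟩ := exists_of_mem_occurrences t hi
    simp [h]
  rw [elemPath, List.length_flatMap, List.map_congr_left this, List.map_const', List.sum_replicate,
    smul_eq_mul, mul_comm, ← Finset.card_filter, occurrences]
  congr 1

/-- The part of the cycle from `v^{U,x}_1` to `v^{U,x}_4`. -/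
noncomputable def elemBlock (x : Fin I.u) : List I.Vertex :=
  [u1 x, lastVertex (!t x) x, lastVertex (t x) x] ++ (elemPath t x ++ [u4 x])

theorem isChain_elemBlock (hI : I.SimpleForm) (x : Fin I.u) : (elemBlock t x).IsChain I.Arc := by
  rw [elemBlock, List.isChain_append, List.isChain_append]
  refine ⟨?_, ⟨isChain_elemPath t x, by simp, ?_⟩, ?_⟩
  · cases t x
    · simpa using ⟨Arc.u12 x, Arc.u23 x⟩
    · simpa using ⟨Arc.u13 x, Arc.u32 x⟩
  · simpa using elemPath_last t x
  · intro v hv w hw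
    simp only [List.getLast?_cons_cons, List.getLast?_singleton, Option.mem_some_iff] at hv
    subst hv
    rw [List.head?_append_of_ne_nil _ (elemPath_ne_nil t hI x)] at hw
    exact elemPath_head t x w hw

variable (m : Fin I.s → ℕ)

/-- The detour from one side of the component of a set to the other. -/
def detour (i : Fin I.s) (t : Bool) : List I.Vertex :=
  if t then [s5 i, s4 i, s3 i] else [s3 i, s4 i, s5 i]

/-- The part of the cycle that runs through the forward triple of an entry of `S^i`. -/
def forwardTriple (i : Fin I.s) (j : Fin (I.k i)) : List I.Vertex :=
  [a i (!t (I.entry i j)) j, b i (!t (I.entry i j)) j, c i (!t (I.entry i j)) j] ++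
    if j.val = m i then detour i (!t (I.entry i j)) else []

theorem length_forwardTriple (i : Fin I.s) (j : Fin (I.k i)) :
    (forwardTriple t m i j).length = 3 + if j.val = m i then 3 else 0 := by
  rw [forwardTriple, detour]
  split_ifs <;> rfl

/-- The part of the cycle from `v^{S,i}_1` to `v^{S,i}_2`. -/
def setBlock (i : Fin I.s) : List I.Vertex :=
  s1 i :: ((List.finRange (I.k i)).flatMap (forwardTriple t m i) ++ [s2 i])

/-- At the position `m i`, the entries of `S^i` change sides. -/
def IsSwitch (i : Fin I.s) : Prop :=
  ∃ j j' : Fin (I.k i), j.val = m i ∧ j.val + 1 = j'.val ∧ t (I.entry i j) ≠ t (I.entry i j')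

variable {m} {i : Fin I.s} (hm : IsSwitch t m i)

include hm

theorem isChain_forwardTriple (j : Fin (I.k i)) : (forwardTriple t m i j).IsChain I.Arc := by
  obtain ⟨p, p', hp, hp', -⟩ := hm
  rw [forwardTriple, List.isChain_append]
  refine ⟨by simpa using ⟨Arc.ab _ _ _, Arc.bc _ _ _⟩, ?_, ?_⟩
  · rw [detour]
    split_ifs
    · simpa using ⟨Arc.s54 i, Arc.s43 i⟩
    · simpa using ⟨Arc.s34 i, Arc.s45 i⟩
    · simp
  · intro v hv w hw
    simp only [List.getLast?_cons_cons, List.getLast?_singleton, Option.mem_some_iff] at hv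
    subst hv
    by_cases hj : j.val = m i
    · rw [if_pos hj, detour] at hw
      -- The switch has a successor position `p'`, so it is not last and the arc into the detour
      -- exists.
      have hlt : j.val + 1 < I.k i := by omega
      cases h : t (I.entry i j)
      · obtain rfl : s5 i = w := by simpa [h] using hw
        exact .cs5 i j hlt
      · obtain rfl : s3 i = w := by simpa [h] using hw
        exact .cs3 i j hlt
    · simp [hj] at hw

/-- Neighbouring triples are joined by `Arc.ca` whatever their parts. At the switch the detour
changes parts, and so does the forward triple of the next entry, since the two entries are on
different sides. -/
theorem isChain_flatMap_forwardTriple :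
    ((List.finRange (I.k i)).flatMap (forwardTriple t m i)).IsChain I.Arc := by
  refine List.isChain_flatMap (by simp [forwardTriple])
    (fun j _ => isChain_forwardTriple t hm j) ?_
  refine (List.isChain_finRange _).imp fun j j' hj v hv w hw => ?_
  obtain rfl : a i (!t (I.entry i j')) j' = w := by simpa [forwardTriple] using hw
  by_cases hjm : j.val = m i
  · obtain ⟨p, p', hp, hp', hne⟩ := hm
    obtain rfl : p = j := Fin.ext (hp.trans hjm.symm)
    obtain rfl : p' = j' := Fin.ext (hp'.symm.trans hj)
    rw [forwardTriple, if_pos hjm, detour] at hv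
    cases h : t (I.entry i p) <;> rw [h] at hv hne
    · obtain rfl : s3 i = v := by simpa using hv
      obtain h' : t (I.entry i p') = true := by simpa using hne.symm
      rw [h']
      exact .s3a i p' (by omega)
    · obtain rfl : s5 i = v := by simpa using hv
      obtain h' : t (I.entry i p') = false := by simpa using hne.symm
      rw [h']
      exact .s5a i p' (by omega)
  · obtain rfl : c i (!t (I.entry i j)) j = v := by simpa [forwardTriple, hjm] using hv
    exact .ca i _ _ j j' hj

theorem isChain_setBlock : (setBlock t m i).IsChain I.Arc := by
  obtain ⟨p, p', hp, hp', hne⟩ := id hm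
  have hk : 0 < I.k i := p.pos
  rw [setBlock, ← List.singleton_append, List.isChain_append, List.isChain_append]
  refine ⟨by simp, ⟨isChain_flatMap_forwardTriple t hm, by simp, ?_⟩, ?_⟩
  · rw [List.getLast?_flatMap_finRange (by omega) (v := c i (!t (I.entry i ⟨I.k i - 1, by omega⟩))
      ⟨I.k i - 1, by omega⟩) (by
        rw [forwardTriple, if_neg (by simp only; omega)]; rfl)]
    simpa using Arc.cs2 i _ _ (Nat.sub_add_cancel hk)
  · intro v hv w hw
    rw [List.head?_append, List.head?_flatMap_finRange hk rfl] at hw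
    obtain rfl : s1 i = v := by simpa using hv
    obtain rfl : a i _ ⟨0, hk⟩ = w := Option.some.inj hw
    exact .s1a i _ _ rfl

theorem length_setBlock : (setBlock t m i).length = 5 + 3 * (I.S i).card := by
  obtain ⟨p, p', hp, hp', hne⟩ := hm
  have h1 : ∑ j : Fin (I.k i), (if j.val = m i then 3 else 0) = 3 := by
    rw [Finset.sum_eq_single p]
    · exact if_pos hp
    · intro j _ hj
      exact if_neg fun h => hj (Fin.ext (h.trans hp.symm))
    · simp
  rw [setBlock, List.length_cons, List.length_append, List.length_flatMap, ← List.ofFn_eq_map,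
    List.sum_ofFn]
  simp only [length_forwardTriple, Finset.sum_add_distrib, h1]
  simp [k]
  omega

omit hm

/-- Without a change between neighbours `t` would be constant on the set. Allowing every `m` with `m
i = n` lets the positions be chosen set by set and then merged into one function. -/
theorem exists_isSwitch {i : Fin I.s} (h : ∀ r, ∃ x ∈ I.S i, t x = r) :
    ∃ n, ∀ m : Fin I.s → ℕ, m i = n → IsSwitch t m i := by
  by_contra! hno
  have hconst : ∀ (n : ℕ) (hn : n < I.k i), t (I.entry i ⟨n, hn⟩) =
      t (I.entry i ⟨0, by omega⟩) := by
    intro n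
    induction n with
    | zero => exact fun _ => rfl
    | succ n ih =>
      intro hn
      rw [← ih (by omega)]
      by_contra hne
      obtain ⟨m, hm, hs⟩ := hno n
      exact hs ⟨⟨n, by omega⟩, ⟨n + 1, hn⟩, hm.symm, rfl, fun h => hne h.symm⟩
  obtain ⟨x, hx, hx'⟩ := h true
  obtain ⟨y, hy, hy'⟩ := h false
  obtain ⟨j, rfl⟩ := exists_entry_eq hx
  obtain ⟨j', rfl⟩ := exists_entry_eq hy
  have := (hconst j j.2).trans (hconst j' j'.2).symm
  simp [hx', hy'] at this

variable (m) in
/-- The Hamiltonian cycle for a choice of sides. -/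
noncomputable def cycleOf : List I.Vertex :=
  (List.finRange I.u).flatMap (elemBlock t) ++
    (conn1 :: ((List.finRange I.s).flatMap (setBlock t m) ++ [conn2]))

theorem elemBlock_getLast? (x : Fin I.u) : (elemBlock t x).getLast? = some (u4 x) := by
  rw [elemBlock, ← List.append_assoc, List.getLast?_concat]

theorem setBlock_getLast? (i : Fin I.s) : (setBlock t m i).getLast? = some (s2 i) := by
  rw [setBlock, ← List.cons_append, List.getLast?_concat]

theorem isChain_cycleOf (hI : I.SimpleForm) (hu : 0 < I.u) (hm : ∀ i, IsSwitch t m i) :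
    (cycleOf t m).IsChain I.Arc := by
  have hs := hI.s_pos hu
  rw [cycleOf, ← List.singleton_append, List.isChain_append, List.isChain_append,
    List.isChain_append]
  refine ⟨?_, ⟨by simp, ⟨?_, by simp, ?_⟩, ?_⟩, ?_⟩
  · refine List.isChain_flatMap (by simp [elemBlock]) (fun x _ => isChain_elemBlock t hI x) ?_
    refine (List.isChain_finRange _).imp fun x y hxy v hv w hw => ?_
    rw [elemBlock_getLast?, Option.mem_some_iff] at hv
    obtain rfl : u1 y = w := Option.some.inj hw
    subst hv
    exact .u4u1 x y hxy
  · refine List.isChain_flatMap (by simp [setBlock]) (fun i _ => isChain_setBlock t (hm i)) ?_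
    refine (List.isChain_finRange _).imp fun x y hxy v hv w hw => ?_
    rw [setBlock_getLast?, Option.mem_some_iff] at hv
    obtain rfl : s1 y = w := Option.some.inj hw
    subst hv
    exact .s2s1 x y hxy
  · intro v hv w hw
    rw [List.getLast?_flatMap_finRange (by omega) (setBlock_getLast? t _)] at hv
    obtain rfl : s2 _ = v := Option.some.inj hv
    obtain rfl : conn2 = w := Option.some.inj hw
    exact .s2conn2 _ (Nat.sub_add_cancel hs)
  · intro v hv w hw
    rw [List.head?_append, List.head?_flatMap_finRange hs rfl] at hw
    obtain rfl : conn1 = v := Option.some.inj hv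
    obtain rfl : s1 _ = w := Option.some.inj hw
    exact .conn1s1 _ rfl
  · intro v hv w hw
    rw [List.getLast?_flatMap_finRange (by omega) (elemBlock_getLast? t _)] at hv
    obtain rfl : u4 _ = v := Option.some.inj hv
    obtain rfl : conn1 = w := Option.some.inj hw
    exact .u4conn1 _ (Nat.sub_add_cancel hu)

theorem length_cycleOf (hm : ∀ i, IsSwitch t m i) :
    (cycleOf t m).length = Fintype.card I.Vertex := by
  have h1 : ∀ x, (elemBlock t x).length = 4 + 3 * ∑ i, if x ∈ I.S i then 1 else 0 := by
    intro x
    rw [elemBlock, List.length_append, List.length_append, length_elemPath]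
    simp only [List.length_cons, List.length_nil]
    omega
  have h2 : ∑ x, ∑ i, (if x ∈ I.S i then 1 else 0) = I.totalCard := by
    rw [Finset.sum_comm]
    simp [totalCard]
  rw [card_vertex, cycleOf, List.length_append, List.length_cons, List.length_append,
    List.length_flatMap, List.length_flatMap, ← List.ofFn_eq_map, ← List.ofFn_eq_map, List.sum_ofFn,
    List.sum_ofFn, Finset.sum_congr rfl fun x _ => h1 x,
    Finset.sum_congr rfl fun i _ => length_setBlock t (hm i), Finset.sum_add_distrib,
    Finset.sum_add_distrib, ← Finset.mul_sum, ← Finset.mul_sum, h2]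
  simp [totalCard]
  omega

/-- The triple of `x` in part `t x` lies in the block of `x`, the one in the other part in the block
of the set; `s3`, `s4`, `s5` lie in the detour at the switch. -/
theorem mem_cycleOf (hm : ∀ i, IsSwitch t m i) (v : I.Vertex) : v ∈ cycleOf t m := by
  have hU : ∀ x, ∀ w ∈ elemBlock t x, w ∈ cycleOf t m := fun x w hw =>
    List.mem_append_left _ (List.mem_flatMap.2 ⟨x, List.mem_finRange x, hw⟩)
  have hS : ∀ i, ∀ w ∈ setBlock t m i, w ∈ cycleOf t m := fun i w hw =>
    List.mem_append_right _ (List.mem_cons_of_mem _ (List.mem_append_left _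
      (List.mem_flatMap.2 ⟨i, List.mem_finRange i, hw⟩)))
  have hF : ∀ i j, ∀ w ∈ forwardTriple t m i j, w ∈ cycleOf t m := fun i j w hw =>
    hS i w (List.mem_cons_of_mem _ (List.mem_append_left _
      (List.mem_flatMap.2 ⟨j, List.mem_finRange j, hw⟩)))
  have hB : ∀ i j, ∀ w ∈ tripleOf t (I.entry i j) i, w ∈ cycleOf t m := fun i j w hw =>
    hU (I.entry i j) w (List.mem_append_right _ (List.mem_append_left _
      (List.mem_flatMap.2 ⟨i, mem_occurrences.2 (entry_mem i j), hw⟩)))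
  have hT : ∀ i r j, a i r j ∈ cycleOf t m ∧ b i r j ∈ cycleOf t m ∧ c i r j ∈ cycleOf t m := by
    intro i r j
    obtain rfl | h : r = t (I.entry i j) ∨ r = !t (I.entry i j) := by
      cases r <;> cases t (I.entry i j) <;> simp
    · have := hB i j
      rw [tripleOf_entry] at this
      simpa using And.intro (this _ (by simp)) (And.intro (this _ (by simp)) (this _ (by simp)))
    · subst h
      exact ⟨hF i j _ (by simp [forwardTriple]), hF i j _ (by simp [forwardTriple]),
        hF i j _ (by simp [forwardTriple])⟩
  have hD : ∀ i, s3 i ∈ cycleOf t m ∧ s4 i ∈ cycleOf t m ∧ s5 i ∈ cycleOf t m := by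
    intro i
    obtain ⟨p, -, hp, -, -⟩ := hm i
    have h : ∀ w ∈ detour i (!t (I.entry i p)), w ∈ cycleOf t m := fun w hw =>
      hF i p w (by rw [forwardTriple, if_pos hp]; exact List.mem_append_right _ hw)
    refine ⟨h _ ?_, h _ ?_, h _ ?_⟩ <;> cases t (I.entry i p) <;> simp [detour]
  cases v with
  | u1 x => exact hU x _ (by simp [elemBlock])
  | u2 x => exact hU x _ (by cases h : t x <;> simp [elemBlock, h])
  | u3 x => exact hU x _ (by cases h : t x <;> simp [elemBlock, h])
  | u4 x => exact hU x _ (by simp [elemBlock])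
  | s1 i => exact hS i _ (by simp [setBlock])
  | s2 i => exact hS i _ (by simp [setBlock])
  | s3 i => exact (hD i).1
  | s4 i => exact (hD i).2.1
  | s5 i => exact (hD i).2.2
  | a i r j => exact (hT i r j).1
  | b i r j => exact (hT i r j).2.1
  | c i r j => exact (hT i r j).2.2
  | conn1 => simp [cycleOf]
  | conn2 => simp [cycleOf]

theorem isHamiltonianCycle_cycleOf (hI : I.SimpleForm) (hu : 0 < I.u)
    (hm : ∀ i, IsSwitch t m i) : IsHamiltonianCycle I.graph (cycleOf t m) := by
  refine isHamiltonianCycle_of_isChain (isChain_cycleOf t hI hu hm) (fun v hv w hw => ?_)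
    (mem_cycleOf t hm) (length_cycleOf t hm)
  rw [cycleOf, List.head?_append, List.head?_flatMap_finRange hu rfl] at hw
  obtain rfl : u1 _ = w := Option.some.inj hw
  rw [cycleOf, ← List.cons_append, ← List.append_assoc, List.getLast?_concat] at hv
  obtain rfl : conn2 = v := Option.some.inj hv
  exact .conn2u1 _ rfl

theorem tour_cycleOf (hu : 0 < I.u) : I.tour hu (cycleOf t m) = cycleOf t m := by
  have h : (cycleOf t m).head? = some (u1 ⟨0, hu⟩) := by
    rw [cycleOf, List.head?_append, List.head?_flatMap_finRange hu rfl]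
    rfl
  obtain ⟨r, hr⟩ := List.head?_eq_some_iff.1 h
  rw [tour, hr, List.idxOf_cons_self, List.rotate_zero]

/-- The list already starts at the first `u1` and shows `lastVertex (!t x) x` before `lastVertex (t
x) x`; the opposite side would reverse their positions. -/
theorem side_cycleOf (hI : I.SimpleForm) (hu : 0 < I.u) (hm : ∀ i, IsSwitch t m i) (x : Fin I.u) :
    (isCycleCover_tour (hu := hu) (isHamiltonianCycle_cycleOf t hI hu hm)).side x = t x := by
  have h := isHamiltonianCycle_cycleOf t hI hu hm
  by_contra hne
  have hlt := idxOf_lastVertex_lt (hu := hu) h x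
  have hx := List.mem_finRange x
  rw [Bool.eq_not_of_ne hne, Bool.not_not, tour_cycleOf] at hlt
  obtain ⟨L, L', hL⟩ := List.append_of_mem hx
  have hnd := h.1
  have hs : [lastVertex (!t x) x, lastVertex (t x) x].Sublist (cycleOf t m) := by
    rw [cycleOf, hL, List.flatMap_append, List.flatMap_cons, elemBlock]
    refine List.Sublist.trans ?_ (List.sublist_append_left _ _)
    refine List.Sublist.trans ?_ (List.sublist_append_right _ _)
    refine List.Sublist.trans ?_ (List.sublist_append_left _ _)
    refine List.Sublist.trans ?_ (List.sublist_append_left _ _)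
    exact List.sublist_cons_self _ _
  obtain ⟨f, hf⟩ := List.sublist_iff_exists_fin_orderEmbedding_get_eq.1 hs
  have h0 := hf ⟨0, by simp⟩
  have h1 := hf ⟨1, by simp⟩
  simp only [List.get_eq_getElem, List.getElem_cons_zero, List.getElem_cons_succ] at h0 h1
  rw [h0, h1, hnd.idxOf_getElem, hnd.idxOf_getElem] at hlt
  exact absurd (f.lt_iff_lt.1 (Fin.lt_def.2 hlt)) (by simp)

end Construction

/-- Every solution comes from a Hamiltonian cycle. -/
theorem exists_isHamiltonianCycle (hI : I.SimpleForm) (hu : 0 < I.u) {A B : Finset (Fin I.u)}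
    (h : I.IsSolution A B) :
    ∃ l, IsHamiltonianCycle I.graph l ∧ I.firstPart hu l = A ∧ I.secondPart hu l = B := by
  set t : Fin I.u → Bool := fun x => decide (x ∈ A) with ht
  have hB : ∀ x, x ∈ B ↔ x ∉ A := fun x =>
    ⟨fun hx hx' => Finset.disjoint_left.1 h.disjoint hx' hx, fun hx =>
      (Finset.mem_union.1 (h.union_eq ▸ Finset.mem_univ x)).resolve_left hx⟩
  have hex : ∀ i, ∃ n, ∀ m : Fin I.s → ℕ, m i = n → IsSwitch t m i := by
    refine fun i => exists_isSwitch t fun r => ?_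
    obtain ⟨hA', hB'⟩ := h.split i
    obtain ⟨x, hx, hxA⟩ := Finset.not_subset.1 hA'
    obtain ⟨y, hy, hyB⟩ := Finset.not_subset.1 hB'
    cases r
    · exact ⟨x, hx, by simp [ht, hxA]⟩
    · exact ⟨y, hy, by simpa [ht, hB] using hyB⟩
  choose m hm using hex
  have hm : ∀ i, IsSwitch t m i := fun i => hm i m rfl
  have hl := isHamiltonianCycle_cycleOf t hI hu hm
  refine ⟨cycleOf t m, hl, ?_, ?_⟩
  · ext x
    rw [mem_firstPart hl, side_cycleOf t hI hu hm]
    simp [ht]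
  · ext x
    rw [mem_secondPart hl, side_cycleOf t hI hu hm]
    simp [ht, hB]

end SSP

/-! ### Reading the partition from marks. -/

namespace SSP

/-- The information about a vertex that is used to read off a partition: whether it is
`v^{U,1}_1` (`head`), another `v^{U,i}_1` (`one`), some `v^{U,i}_2` or `v^{U,i}_3`, or any other
vertex. -/
inductive Mark : Type
  | head | one | two | three | other
  deriving DecidableEq

instance : Fintype Mark :=
  ⟨{.head, .one, .two, .three, .other}, by rintro (_ | _ | _ | _ | _) <;> simp⟩

/-- The states of the automaton that reads the vertices: before the cycle, at the start of a
vertex, in a vertex that needs no further attention, in the index `i` of some `v^{U,i}_m` (nothing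
read, read `1`, read something else), and in the number `m` (nothing read, read `1`, `0`, `2`,
`3`); `z` tells whether `i = 1`. -/
inductive Scan : Type
  | before | start | skip | index | indexOne | indexOther
  | num (z : Bool) | numOne (z : Bool) | numZero | numTwo | numThree
  deriving DecidableEq, Fintype

variable {I : SSP}

open Vertex

/-- The mark of a vertex. -/
def mark : I.Vertex → Mark
  | u1 x => if x.val = 0 then .head else .one
  | u2 _ => .two
  | u3 _ => .three
  | _ => .other

/-- Whether a mark belongs to some `v^{U,i}_1`. -/
def Mark.isFirst : Mark → Bool
  | head | one => true
  | _ => false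

/-- The answers obtained from the marks along a tour: at each `v^{U,i}_1`, whether `v^{U,i}_3`
comes next. -/
def answers : List Mark → List Bool
  | [] => []
  | m :: r => if m.isFirst then decide (r.head? = some .three) :: answers r else answers r

/-- The element whose component starts at a vertex. -/
def element : I.Vertex → Option (Fin I.u)
  | u1 x => some x
  | _ => none

theorem element_eq_some {v : I.Vertex} {x : Fin I.u} : element v = some x ↔ v = u1 x := by
  cases v <;> simp [element]

theorem isFirst_mark (v : I.Vertex) : (mark v).isFirst = (element v).isSome := by
  cases v with
  | u1 x =>
    simp only [mark, element]
    split_ifs <;> rfl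
  | _ => rfl

/-- The vertex after `u1 x` is `u3 x` exactly when `side x` is true; `hl` ensures that such a next
vertex exists. -/
theorem answers_map_mark (side : Fin I.u → Bool) {r : List I.Vertex}
    (hc : r.IsChain fun v w => ∀ x, v = u1 x → w = lastVertex (!side x) x)
    (hl : ∀ x, r.getLast? ≠ some (u1 x)) :
    answers (r.map mark) = (r.filterMap element).map side := by
  induction r with
  | nil => rfl
  | cons v r ih =>
    cases r with
    | nil =>
      have hv : element v = none := by
        rw [Option.eq_none_iff_forall_ne_some]
        exact fun x hx => hl x (by rw [element_eq_some.1 hx]; rfl)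
      simp [answers, isFirst_mark, hv]
    | cons w r =>
      rw [List.isChain_cons_cons] at hc
      have ih := ih hc.2 (by simpa using hl)
      rw [List.map_cons, answers, ih, isFirst_mark, List.map_cons, List.head?_cons]
      cases hv : element v with
      | none => simp [hv]
      | some x =>
        rw [hc.1 x (element_eq_some.1 hv)]
        cases hs : side x <;> simp [hv, hs, mark]

section Tour

variable {hu : 0 < I.u} {l : List I.Vertex} (h : IsHamiltonianCycle I.graph l)

include h

/-- By `strictMono` the elements appear in increasing order, and increasing lists with the same
members agree. Hence no element index except 1 has to be decoded. -/
theorem filterMap_element_tour : (I.tour hu l).filterMap element = List.finRange I.u := by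
  have hT := isHamiltonianCycle_tour (hu := hu) h
  have hmono := (isCycleCover_tour (hu := hu) h).strictMono _ (lt_idxOf_tour_formPerm h)
  have hp : ((I.tour hu l).filterMap element).Pairwise (· < ·) := by
    rw [List.pairwise_filterMap]
    have : (I.tour hu l).Pairwise fun v w => (I.tour hu l).idxOf v < (I.tour hu l).idxOf w := by
      rw [List.pairwise_iff_getElem]
      intro m n hm hn hmn
      rwa [hT.1.idxOf_getElem, hT.1.idxOf_getElem]
    refine this.imp fun {v w} hvw x hx y hy => ?_
    rw [element_eq_some] at hx hy
    subst hx hy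
    exact hmono.lt_iff_lt.1 hvw
  have hp' := List.pairwise_lt_finRange I.u
  refine List.Perm.eq_of_pairwise (fun x y _ _ hxy hyx => absurd hxy (lt_asymm hyx)) hp hp' ?_
  rw [List.perm_ext_iff_of_nodup (hp.imp ne_of_lt) (List.nodup_finRange _)]
  intro x
  simpa [element_eq_some] using hT.2.1 (u1 x)

theorem answers_tour :
    answers ((I.tour hu l).map mark) = List.ofFn fun x => decide (x ∈ I.firstPart hu l) := by
  have hT := isHamiltonianCycle_tour (hu := hu) h
  have hσ := isCycleCover_tour (hu := hu) h
  have hpos : 0 < (I.tour hu l).length := List.length_pos_of_mem (hT.2.1 conn1)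
  rw [answers_map_mark hσ.side, filterMap_element_tour h, List.ofFn_eq_map]
  · refine List.map_congr_left fun x _ => ?_
    rw [Bool.eq_iff_iff, decide_eq_true_iff, mem_firstPart h]
  · rw [List.isChain_iff_getElem]
    intro n hn x hx
    have := hσ.apply_u1 x
    rw [← hx, List.formPerm_apply_getElem _ hT.1] at this
    simpa only [Nat.mod_eq_of_lt hn] using this
  -- A final `u1 x` would precede the first `u1`, whose only predecessor is `conn2`.
  · intro x hx
    rw [List.getLast?_eq_getElem?, List.getElem?_eq_getElem (by omega), Option.some_inj] at hx
    obtain ⟨r, hr⟩ := tour_eq_cons (hu := hu) h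
    have h0 : (I.tour hu l)[0] = u1 ⟨0, hu⟩ := by simp [hr]
    have ha := hT.2.2 ((I.tour hu l).length - 1) (by omega)
    simp only [Nat.sub_add_cancel hpos, Nat.mod_self, h0, hx] at ha
    cases ha.to_u1_zero rfl

end Tour

/-! ### The automaton on vertex words. -/

namespace Scan

/-- The transitions of the automaton. -/
def next : Scan → Sym → Scan
  | before, .hash => start
  | before, _ => before
  -- Separators of the instance were absorbed by `before`; from here on a semicolon ends a vertex.
  | _, .semi => start
  | start, .U => index
  | index, .bit true => indexOne
  | index, .bit false => indexOther
  | indexOne, .bit _ => indexOther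
  | indexOne, .comma => num true
  | indexOther, .bit _ => indexOther
  | indexOther, .comma => num false
  | num z, .bit true => numOne z
  | num _, .bit false => numZero
  | numOne _, .bit true => numThree
  | numZero, .bit true => numTwo
  | _, _ => skip

/-- The mark of the vertex whose word ends in the given state. -/
def toMark : Scan → Mark
  | numOne true => .head
  | numOne false => .one
  | numTwo => .two
  | numThree => .three
  | _ => .other

/-- The mark found on reading a symbol. -/
def out (q : Scan) (s : Sym) : Option Mark :=
  if q ≠ before ∧ s = .semi then some q.toMark else none

/-- The marks found on reading a word. -/
def marks : Scan → List Sym → List Mark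
  | _, [] => []
  | q, s :: w => (q.out s).toList ++ marks (q.next s) w

theorem marks_append (q : Scan) (w w' : List Sym) :
    marks q (w ++ w') = marks q w ++ marks (w.foldl next q) w' := by
  induction w generalizing q with
  | nil => rfl
  | cons s w ih => simp [marks, ih]

/-- A word is passed from one state to another without finding a mark. -/
def Passes (q : Scan) (w : List Sym) (q' : Scan) : Prop := marks q w = [] ∧ w.foldl next q = q'

theorem Passes.append {q q' q'' : Scan} {w w' : List Sym} (h : Passes q w q')
    (h' : Passes q' w' q'') : Passes q (w ++ w') q'' := by
  obtain ⟨h1, h2⟩ := h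
  obtain ⟨h3, h4⟩ := h'
  exact ⟨by rw [marks_append, h1, h2, h3]; rfl, by rw [List.foldl_append, h2, h4]⟩

theorem Passes.cons {q q' : Scan} {s : Sym} {w : List Sym} (ho : q.out s = none)
    (h : Passes (q.next s) w q') : Passes q (s :: w) q' :=
  ⟨by rw [marks, ho, h.1]; rfl, h.2⟩

theorem passes_self {q : Scan} {w : List Sym} (h : ∀ s ∈ w, q.out s = none ∧ q.next s = q) :
    Passes q w q := by
  induction w with
  | nil => exact ⟨rfl, rfl⟩
  | cons s w ih =>
    obtain ⟨h1, h2⟩ := h s (by simp)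
    refine .cons h1 ?_
    rw [h2]
    exact ih fun s hs => h s (by simp [hs])

theorem passes_before {w : List Sym} (h : Sym.hash ∉ w) : Passes before w before := by
  refine passes_self fun s hs => ⟨by simp [out], ?_⟩
  cases s with
  | hash => exact absurd hs h
  | _ => rfl

theorem passes_skip {w : List Sym} (h : Sym.semi ∉ w) : Passes skip w skip := by
  refine passes_self fun s hs => ?_
  cases s with
  | semi => exact absurd hs h
  | _ => exact ⟨rfl, rfl⟩

theorem mem_binary {n : ℕ} {s : Sym} (h : s ∈ binary n) : ∃ d, s = .bit d := by
  rw [binary, List.mem_map] at h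
  obtain ⟨d, -, rfl⟩ := h
  exact ⟨d, rfl⟩

theorem binary_one : binary 1 = [.bit true] := by
  rw [binary, Nat.one_bits]; rfl

theorem binary_two : binary 2 = [.bit false, .bit true] := by
  rw [binary, Nat.bit0_bits 1 one_ne_zero, Nat.one_bits]; rfl

theorem binary_three : binary 3 = [.bit true, .bit true] := by
  rw [binary, Nat.bit1_bits 1, Nat.one_bits]; rfl

theorem binary_four : binary 4 = [.bit false, .bit false, .bit true] := by
  rw [binary, Nat.bit0_bits 2 two_ne_zero, Nat.bit0_bits 1 one_ne_zero, Nat.one_bits]; rfl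

theorem passes_indexOther (r : List Bool) : Passes indexOther (r.map Sym.bit) indexOther := by
  refine passes_self fun s hs => ?_
  obtain ⟨d, -, rfl⟩ := List.mem_map.1 hs
  exact ⟨rfl, rfl⟩

/-- With least significant digit first, a positive number other than 1 begins with 0 or has another
digit after its leading 1. -/
theorem passes_index (i : ℕ) :
    Passes index (binary (i + 1)) (if i = 0 then indexOne else indexOther) := by
  split_ifs with hi
  · rw [hi, zero_add, binary_one]
    exact ⟨rfl, rfl⟩
  obtain ⟨m, hm⟩ := Nat.even_or_odd' (i + 1)
  have hm0 : m ≠ 0 := by omega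
  obtain hm | hm := hm
  · rw [hm, binary, Nat.bit0_bits m hm0]
    exact .cons rfl (passes_indexOther _)
  · rw [hm, binary, Nat.bit1_bits]
    cases hr : m.bits with
    | nil =>
      have := Nat.size_eq_bits_len m
      rw [hr, List.length_nil, eq_comm, Nat.size_eq_zero] at this
      exact absurd this hm0
    | cons d r => exact .cons rfl (.cons rfl (passes_indexOther r))

theorem marks_of_passes {w : List Sym} {q : Scan} (h : Passes start w q) (hq : q ≠ before) :
    marks start (w ++ [.semi]) = [q.toMark] ∧ (w ++ [Sym.semi]).foldl next start = start := by
  rw [marks_append, h.1, List.foldl_append, h.2]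
  refine ⟨by simp [marks, out, hq], ?_⟩
  cases q <;> first | rfl | exact absurd rfl hq

theorem passes_start_skip {K : Sym} (hK : K = .S ∨ K = .C) {w : List Sym} (hw : Sym.semi ∉ w) :
    Passes start (K :: w) skip := by
  obtain rfl | rfl := hK <;> exact .cons rfl (passes_skip hw)

theorem semi_notMem_binary (n : ℕ) : Sym.semi ∉ binary n := fun h => by
  obtain ⟨d, hd⟩ := mem_binary h
  cases hd

theorem hash_notMem_binary (n : ℕ) : Sym.hash ∉ binary n := fun h => by
  obtain ⟨d, hd⟩ := mem_binary h
  cases hd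

theorem passes_label (i m : ℕ) {q : Scan}
    (h : Passes (num (decide (i = 0))) (binary m) q) :
    Passes start (.U :: (binary (i + 1) ++ .comma :: binary m)) q := by
  refine .cons rfl ((passes_index i).append (.cons ?_ ?_))
  · split_ifs <;> rfl
  · split_ifs with hi <;> simp [hi] at h <;> exact h

theorem marks_encodeLabel_S (i m : ℕ) :
    marks start (encodeLabel .S i m) = [.other] ∧
      (encodeLabel .S i m).foldl next start = start := by
  have := marks_of_passes (passes_start_skip (Or.inl rfl) (w := binary i ++ .comma :: binary m)
    (by simp [semi_notMem_binary])) (by simp)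
  simpa [encodeLabel, toMark] using this

theorem marks_encodeLabel_U (i m : ℕ) {q : Scan} (hq : q ≠ before)
    (h : Passes (num (decide (i = 0))) (binary m) q) :
    marks start (encodeLabel .U (i + 1) m) = [q.toMark] ∧
      (encodeLabel .U (i + 1) m).foldl next start = start := by
  have := marks_of_passes (passes_label i m h) hq
  simpa [encodeLabel] using this

theorem marks_encodeVertex (v : I.Vertex) :
    marks start (I.encodeVertex v) = [mark v] ∧
      (I.encodeVertex v).foldl next start = start := by
  have hC : ∀ n, marks start (.C :: (binary n ++ [Sym.semi])) = [.other] ∧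
      (Sym.C :: (binary n ++ [Sym.semi])).foldl next start = start := fun n =>
    marks_of_passes (passes_start_skip (Or.inr rfl) (semi_notMem_binary n)) (by simp)
  cases v with
  | u1 x =>
    have := marks_encodeLabel_U x.val 1 (q := numOne (decide (x.val = 0))) (by simp)
      (by rw [binary_one]; exact ⟨rfl, rfl⟩)
    rwa [show (numOne (decide (x.val = 0))).toMark = mark (u1 x) by
      by_cases hx : x.val = 0 <;> simp [mark, hx, toMark]] at this
  | u2 x =>
    exact marks_encodeLabel_U x.val 2 (q := numTwo) (by simp)
      (by rw [binary_two]; exact ⟨rfl, rfl⟩)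
  | u3 x =>
    exact marks_encodeLabel_U x.val 3 (q := numThree) (by simp)
      (by rw [binary_three]; exact ⟨rfl, rfl⟩)
  | u4 x =>
    exact marks_encodeLabel_U x.val 4 (q := skip) (by simp)
      (by rw [binary_four]; exact ⟨rfl, rfl⟩)
  | conn1 => exact hC 1
  | conn2 => exact hC 2
  | _ => exact marks_encodeLabel_S _ _

theorem marks_flatMap_encodeVertex (l : List I.Vertex) :
    marks start (l.flatMap I.encodeVertex) = l.map mark := by
  induction l with
  | nil => rfl
  | cons v l ih =>
    obtain ⟨h1, h2⟩ := marks_encodeVertex v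
    rw [List.flatMap_cons, marks_append, h1, h2, ih]
    rfl

theorem marks_encode (x : CycleInput) : marks before x.encode = x.l.map mark := by
  have hI : Sym.hash ∉ x.I.encodeInstance := by
    simp [encodeInstance, hash_notMem_binary]
  obtain ⟨h1, h2⟩ := passes_before hI
  rw [CycleInput.encode, marks_append, h1, h2]
  exact marks_flatMap_encodeVertex x.l

end Scan

end SSP

/-! ### The Turing machine. -/

namespace SSP

open Turing

namespace Reader

/-- The stacks of the machine: the input, the marks before and from `v^{U,1}_1` on, and the
output. -/
inductive Stack : Type
  | input | marks (late : Bool) | output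
  deriving DecidableEq, Fintype

/-- The alphabets of the stacks. -/
abbrev Symbol : Stack → Type
  | .input => Sym
  | .marks _ => Mark
  | .output => Bool

/-- The labels of the program: reading the input, and emptying a stack of marks. -/
inductive Label : Type
  | scan | unwind (late : Bool)
  deriving DecidableEq, Fintype

/-- The internal states: the state of the automaton that reads the vertices, whether `v^{U,1}_1`
has been read, the current and the previous mark, and whether the stack in use is exhausted. -/
structure State : Type where
  scan : Scan
  seen : Bool
  cur : Option Mark
  prev : Option Mark
  done : Bool
  deriving DecidableEq, Fintype

/-- The initial state. -/
def startState : State := ⟨.before, false, none, none, false⟩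

/-- The effect on the state of reading an input symbol. -/
def readSym (v : State) : Option Sym → State
  | none => { startState with done := true }
  | some s => 
    -- The flag is raised by the `head` mark itself, so that mark goes onto the late stack.
    ⟨v.scan.next s, v.seen || decide (v.scan.out s = some .head), v.scan.out s, none, false⟩

/-- The effect on the state of taking a mark from a stack. -/
def readMark (v : State) : Option Mark → State
  | none => { v with done := true }
  | some m => { v with cur := some m, prev := v.cur, done := false }

/-- The program. -/
def program : Label → TM2.Stmt Symbol Label State
  | .scan =>
    .pop .input readSym <|
    .branch State.done (.goto fun _ => .unwind false) <|
    .branch (fun v => v.cur.isSome)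
      (.branch State.seen
        (.push (.marks true) (fun v => v.cur.getD .other) (.goto fun _ => .scan))
        (.push (.marks false) (fun v => v.cur.getD .other) (.goto fun _ => .scan)))
      (.goto fun _ => .scan)
  | .unwind late =>
    .pop (.marks late) readMark <|
    -- The final configuration must carry the initial internal state.
    .branch State.done (if late then .load (fun _ => startState) .halt else .goto fun _ => .unwind true) <|
    .branch (fun v => v.cur.any Mark.isFirst)
      (.push .output (fun v => decide (v.prev = some .three)) (.goto fun _ => .unwind late))
      (.goto fun _ => .unwind late)

/-- The machine that reads off a partition from a Hamiltonian cycle. -/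
def machine : FinTM2 where
  K := Stack
  k₀ := .input
  k₁ := .output
  Γ := Symbol
  Λ := Label
  main := .scan
  σ := State
  initialState := startState
  Γk₀Fin := inferInstanceAs (Fintype Sym)
  m := program

/-- The contents of the stacks. -/
def contents (w : List Sym) (E L : List Mark) (o : List Bool) : ∀ k, List (Symbol k)
  | .input => w
  | .marks false => E
  | .marks true => L
  | .output => o

variable {w w' : List Sym} {E E' L L' : List Mark} {o o' : List Bool}

theorem update_input : Function.update (contents w E L o) .input w' = contents w' E L o := by
  funext k
  rcases k with _ | (_ | _) | _ <;> rfl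

theorem update_early : Function.update (contents w E L o) (.marks false) E' = contents w E' L o := by
  funext k
  rcases k with _ | (_ | _) | _ <;> rfl

theorem update_late : Function.update (contents w E L o) (.marks true) L' = contents w E L' o := by
  funext k
  rcases k with _ | (_ | _) | _ <;> rfl

theorem update_output : Function.update (contents w E L o) .output o' = contents w E L o' := by
  funext k
  rcases k with _ | (_ | _) | _ <;> rfl

/-- The machine gets from one configuration to another in the given number of steps. -/
def Runs (n : ℕ) (x y : TM2.Cfg Symbol Label State) : Prop :=
  (flip bind (TM2.step program))^[n] (some x) = some y

theorem Runs.trans {m n : ℕ} {x y z : TM2.Cfg Symbol Label State} (h : Runs m x y)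
    (h' : Runs n y z) : Runs (m + n) x z := by
  rw [Runs, add_comm, Function.iterate_add_apply, h, h']

theorem runs_one {x y : TM2.Cfg Symbol Label State} (h : TM2.step program x = some y) :
    Runs 1 x y := h

/-- The two stacks of marks after a list of marks has been added. -/
def distribute : Bool → List Mark → List Mark → List Mark → List Mark × List Mark
  | _, E, L, [] => (E, L)
  | seen, E, L, m :: r =>
    if seen || decide (m = .head) then distribute true E (m :: L) r
    else distribute false (m :: E) L r

theorem distribute_true (r : List Mark) : distribute true E L r = (E, r.reverse ++ L) := by
  induction r generalizing L with
  | nil => rfl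
  | cons m r ih => simp [distribute, ih]

theorem distribute_false {r : List Mark} (h : Mark.head ∉ r) (r' : List Mark) :
    distribute false E L (r ++ .head :: r') = (r.reverse ++ E, r'.reverse ++ .head :: L) := by
  induction r generalizing E with
  | nil => simp [distribute, distribute_true]
  | cons m r ih =>
    rw [List.mem_cons, not_or] at h
    simp [distribute, Ne.symm h.1, ih h.2]

theorem step_scan (s : Sym) (w : List Sym) (v : State) (E L : List Mark) :
    TM2.step program ⟨some .scan, v, contents (s :: w) E L []⟩ =
      some ⟨some .scan, readSym v (some s),
        contents w (distribute v.seen E L (v.scan.out s).toList).1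
          (distribute v.seen E L (v.scan.out s).toList).2 []⟩ := by
  cases ho : v.scan.out s with
  | none => simp [program, contents, readSym, ho, distribute, update_input]
  | some m =>
    cases hs : v.seen || decide (m = .head) <;>
      simp [program, contents, readSym, ho, hs, distribute, update_input, update_early, update_late]

theorem distribute_out_append (v : State) (s : Sym) (r : List Mark) :
    distribute v.seen E L ((v.scan.out s).toList ++ r) =
      distribute (readSym v (some s)).seen (distribute v.seen E L (v.scan.out s).toList).1
        (distribute v.seen E L (v.scan.out s).toList).2 r := by
  cases ho : v.scan.out s with
  | none => simp [readSym, ho, distribute]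
  | some m => cases hs : v.seen || decide (m = .head) <;> simp [readSym, ho, hs, distribute]

theorem runs_scan (w : List Sym) (v : State) (E L : List Mark) :
    Runs (w.length + 1) ⟨some .scan, v, contents w E L []⟩
      ⟨some (.unwind false), { startState with done := true },
        contents [] (distribute v.seen E L (v.scan.marks w)).1
          (distribute v.seen E L (v.scan.marks w)).2 []⟩ := by
  induction w generalizing v E L with
  | nil =>
    refine runs_one ?_
    simp [program, contents, readSym, startState, Scan.marks, distribute, update_input]
  | cons s w ih =>
    rw [List.length_cons, add_comm, Scan.marks, distribute_out_append]
    exact (runs_one (step_scan s w v E L)).trans (ih (readSym v (some s)) _ _)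

/-- The effect of unwinding a list of marks on the current mark and the output. -/
def unwind : Option Mark → List Bool → List Mark → Option Mark × List Bool
  | cur, o, [] => (cur, o)
  | cur, o, m :: r =>
    unwind (some m) (if m.isFirst then decide (cur = some .three) :: o else o) r

theorem unwind_append (cur : Option Mark) (o : List Bool) (r r' : List Mark) :
    unwind cur o (r ++ r') = unwind (unwind cur o r).1 (unwind cur o r).2 r' := by
  induction r generalizing cur o with
  | nil => rfl
  | cons m r ih => simp [unwind, ih]

/-- Marks are taken from the end, so the mark taken just before is the next one along the tour;
pushing the answers restores their order. -/
theorem unwind_reverse (r : List Mark) : unwind none [] r.reverse = (r.head?, answers r) := by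
  induction r with
  | nil => rfl
  | cons m r ih => simp [unwind_append, ih, unwind, answers]

theorem step_unwind_early (m : Mark) (E L : List Mark) (v : State) (o : List Bool) :
    TM2.step program ⟨some (.unwind false), v, contents [] (m :: E) L o⟩ =
      some ⟨some (.unwind false), readMark v (some m),
        contents [] E L (if m.isFirst then decide (v.cur = some .three) :: o else o)⟩ := by
  cases hm : m.isFirst <;>
    simp [program, contents, readMark, hm, update_early, update_output]

theorem step_unwind_late (m : Mark) (L : List Mark) (v : State) (o : List Bool) :
    TM2.step program ⟨some (.unwind true), v, contents [] [] (m :: L) o⟩ =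
      some ⟨some (.unwind true), readMark v (some m),
        contents [] [] L (if m.isFirst then decide (v.cur = some .three) :: o else o)⟩ := by
  cases hm : m.isFirst <;>
    simp [program, contents, readMark, hm, update_late, update_output]

theorem runs_unwind_early (E L : List Mark) (v : State) (o : List Bool) :
    ∃ v' : State, v'.cur = (unwind v.cur o E).1 ∧
      Runs (E.length + 1) ⟨some (.unwind false), v, contents [] E L o⟩
        ⟨some (.unwind true), v', contents [] [] L (unwind v.cur o E).2⟩ := by
  induction E generalizing v o with
  | nil =>
    refine ⟨{ v with done := true }, rfl, runs_one ?_⟩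
    simp [program, contents, readMark, update_early, unwind]
  | cons m E ih =>
    obtain ⟨v', h1, h2⟩ := ih (readMark v (some m)) _
    refine ⟨v', h1, ?_⟩
    rw [List.length_cons, add_comm]
    exact (runs_one (step_unwind_early m E L v o)).trans h2

theorem runs_unwind_late (L : List Mark) (v : State) (o : List Bool) :
    Runs (L.length + 1) ⟨some (.unwind true), v, contents [] [] L o⟩
      ⟨none, startState, contents [] [] [] (unwind v.cur o L).2⟩ := by
  induction L generalizing v o with
  | nil =>
    refine runs_one ?_
    simp [program, contents, readMark, update_late, unwind]
  | cons m L ih =>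
    rw [List.length_cons, add_comm]
    exact (runs_one (step_unwind_late m L v o)).trans (ih (readMark v (some m)) _)

/-- Emptying the early stack and then the late one reads `head :: L ++ E`, the rotated tour, from
its end. The three phases take `|w| + 1`, `|E| + 1` and `|L| + 2` steps. -/
theorem runs_all {E L : List Mark} (w : List Sym) (hE : Mark.head ∉ E)
    (hw : Scan.before.marks w = E ++ .head :: L) :
    Runs (w.length + E.length + L.length + 4) ⟨some .scan, startState, contents w [] [] []⟩
      ⟨none, startState, contents [] [] [] (answers (.head :: L ++ E))⟩ := by
  have h1 := runs_scan w startState [] []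
  obtain ⟨v', h2, h3⟩ := runs_unwind_early E.reverse (L.reverse ++ [.head])
    { startState with done := true } []
  have h4 := runs_unwind_late (L.reverse ++ [.head]) v' (unwind none [] E.reverse).2
  have hd : distribute startState.seen [] [] (startState.scan.marks w) =
      (E.reverse, L.reverse ++ [.head]) := by
    have := distribute_false (E := []) (L := []) hE L
    rw [List.append_nil] at this
    exact hw ▸ this
  rw [hd] at h1
  have hu : unwind v'.cur (unwind none [] E.reverse).2 (L.reverse ++ [.head]) =
      ((Mark.head :: L ++ E).head?, answers (.head :: L ++ E)) := by
    rw [h2, ← unwind_reverse, List.reverse_append, List.reverse_cons]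
    exact (unwind_append none [] _ _).symm
  rw [hu] at h4
  have := (h1.trans h3).trans h4
  simp only [List.length_reverse, List.length_append, List.length_cons, List.length_nil] at this
  convert this using 1
  omega

/-- Started on the word of an input, the machine outputs the answer in linear time. -/
theorem runs_encode (x : CycleInput) : ∃ n ≤ 2 * x.encode.length + 3,
    Runs n ⟨some .scan, startState, contents x.encode [] [] []⟩
      ⟨none, startState, contents [] [] [] x.readOff⟩ := by
  have hmem := x.isHamiltonianCycle.2.1 (Vertex.u1 ⟨0, x.u_pos⟩)
  obtain ⟨l₁, l₂, hl, hl₁⟩ : ∃ l₁ l₂, x.l = l₁ ++ Vertex.u1 ⟨0, x.u_pos⟩ :: l₂ ∧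
      Vertex.u1 ⟨0, x.u_pos⟩ ∉ l₁ := List.eq_append_cons_of_mem hmem
  have hE : Mark.head ∉ l₁.map mark := by
    rw [List.mem_map]
    rintro ⟨v, hv, hm⟩
    refine hl₁ ?_
    cases v with
    | u1 y =>
      by_cases hy : y.val = 0
      · rwa [show y = ⟨0, x.u_pos⟩ from Fin.ext hy] at hv
      · simp [mark, hy] at hm
    | _ => simp [mark] at hm
  have hmarks : Scan.before.marks x.encode = l₁.map mark ++ .head :: l₂.map mark := by
    rw [Scan.marks_encode, hl]
    simp [mark]
  have htour : x.I.tour x.u_pos x.l = Vertex.u1 ⟨0, x.u_pos⟩ :: l₂ ++ l₁ := by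
    rw [tour, hl, List.idxOf_append_of_notMem hl₁, List.idxOf_cons_self, add_zero,
      List.rotate_append_length_eq]
  have hans : x.readOff = answers (.head :: l₂.map mark ++ l₁.map mark) := by
    rw [CycleInput.readOff, ← answers_tour x.isHamiltonianCycle, htour]
    simp [mark]
  refine ⟨_, ?_, hans ▸ runs_all x.encode hE hmarks⟩
  -- Every vertex word is non-empty, so the number of marks is at most the input length.
  have hlen : x.l.length ≤ (x.l.flatMap x.I.encodeVertex).length := by
    rw [List.length_flatMap]
    refine le_trans (by simp) (List.card_nsmul_le_sum (x.l.map _) 1 fun n hn => ?_)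
    obtain ⟨v, -, rfl⟩ := List.mem_map.1 hn
    cases v <;> simp [encodeVertex, encodeLabel]
  have hlen' : x.encode.length =
      x.I.encodeInstance.length + ((x.l.flatMap x.I.encodeVertex).length + 1) := by
    rw [CycleInput.encode, List.length_append, List.length_cons]
  rw [hl, List.length_append, List.length_cons] at hlen
  rw [List.length_map, List.length_map]
  rw [hl] at hlen'
  omega

theorem initList_machine (w : List Sym) : initList machine w =
    (⟨some .scan, startState, contents w [] [] []⟩ : TM2.Cfg Symbol Label State) := by
  unfold initList
  congr 1
  funext k
  rcases k with _ | (_ | _) | _ <;> rfl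

theorem haltList_machine (o : List Bool) : haltList machine o =
    (⟨none, startState, contents [] [] [] o⟩ : TM2.Cfg Symbol Label State) := by
  unfold haltList
  congr 1
  funext k
  rcases k with _ | (_ | _) | _ <;> rfl

/-- The partition is read off from a Hamiltonian cycle in polynomial time. -/
noncomputable def computable : TM2ComputableInPolyTime
    CycleInput.encode (id : List Bool → List Bool) CycleInput.readOff where
  tm := machine
  inputAlphabet := Equiv.refl Sym
  outputAlphabet := Equiv.refl Bool
  time := 2 * Polynomial.X + 3
  outputsFun x :=
    { steps := (runs_encode x).choose
      evals_in_steps := by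
        have hi := (congrArg (initList machine) (List.map_id x.encode)).trans (initList_machine _)
        have ho := (congrArg (haltList machine) (List.map_id x.readOff)).trans (haltList_machine _)
        exact (congrArg (fun y => (flip bind (TM2.step program))^[_] (some y)) hi).trans
          (Eq.trans (runs_encode x).choose_spec.2 (congrArg some ho).symm)
      steps_le_m := by
        have h := (runs_encode x).choose_spec.1
        simpa using h }

end Reader

end SSP

theorem proposition1 :
    (∀ (I : SSP) (_ : I.SimpleForm) (hu : 0 < I.u),
      -- the size of the graph
      Nat.card I.Vertex = 4 * I.u + 5 * I.s + 6 * I.totalCard + 2 ∧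
      Nat.card {p : I.Vertex × I.Vertex // I.graph.Adj p.1 p.2} =
        7 * I.u + I.s + 18 * I.totalCard + 2 ∧
      -- (i)
      ((¬ ∃ A B, I.IsSolution A B) → ¬ ∃ l, IsHamiltonianCycle I.graph l) ∧
      -- (ii)
      (∀ A B, I.IsSolution A B → ∃ l, IsHamiltonianCycle I.graph l ∧
        I.firstPart hu l = A ∧ I.secondPart hu l = B) ∧
      -- (iii), the partition read off from a Hamiltonian cycle is a solution
      (∀ l, IsHamiltonianCycle I.graph l →
        I.IsSolution (I.firstPart hu l) (I.secondPart hu l))) ∧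
    -- (iii), reading it off takes polynomial time, uniformly in the instance and the cycle
    Nonempty (Turing.TM2ComputableInPolyTime
      SSP.CycleInput.encode (id : List Bool → List Bool) SSP.CycleInput.readOff) := by
  refine ⟨fun I hI hu => ⟨?_, SSP.card_arcs hI hu, fun hno => ?_, fun A B h =>
    SSP.exists_isHamiltonianCycle hI hu h, fun l hl => SSP.isSolution_of_isHamiltonianCycle hl hI⟩,
    ⟨SSP.Reader.computable⟩⟩
  · rw [Nat.card_eq_fintype_card, SSP.card_vertex]
  · rintro ⟨l, hl⟩
    exact hno ⟨_, _, SSP.isSolution_of_isHamiltonianCycle (hu := hu) hl hI⟩
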